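/- Fix $d$ and a truncation function $h\colon\mathbb{R}^d\to\mathbb{R}^d$, i.e. a bounded continuous function with $h(x)=x$ on a neighborhood of the origin. An $\mathbb{R}^d$-valued process $X=(X_t)_{t\ge 0}$ is called additive if $X_0=0$ a.s., it is stochastically continuous, it has càdlàg paths a.s., and it has independent increments. Its system of characteristic triplets $(\gamma_t,A_t,\nu_t)_{t\ge0}$ consists of vectors $\gamma_t\in\mathbb{R}^d$, symmetric non-negative definite real $d\times d$ matrices $A_t$, and Lévy measures $\nu_t$ (Borel measures on $\mathbb{R}^d$ with $\nu_t(\{0\})=0$ and $\int(|x|^2\wedge 1)\,\nu_t(dx)<\infty$) such that, for all $t\ge 0$ and $\xi\in\mathbb{R}^d$, $$\mathbb{E}\bigl[e^{i\xi\cdot X_t}\bigr]=\exp\Bigl[i\xi\cdot\gamma_t-\tfrac12\,\xi\cdot A_t\xi+\int_{\mathbb{R}^d\setminus\{0\}}\bigl(e^{i\xi\cdot x}-1-i\xi\cdot h(x)\bigr)\,\nu_t(dx)\Bigr].$$ The modified second characteristic is the matrix $\tilde A_t$ with entries $(\tilde A_t)_{jk}=(A_t)_{jk}+\int h_j(x)h_k(x)\,\nu_t(dx)$.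 Let $C_\sharp(\mathbb{R}^d)$ be the set of bounded continuous functions $f\colon\mathbb{R}^d\to\mathbb{R}$ that vanish on a neighborhood of the origin, and $C_{\sharp\sharp}(\mathbb{R}^d)$ the set of bounded continuous $f\colon\mathbb{R}^d\to\mathbb{R}$ with $\lim_{x\to0}f(x)/|x|^2=0$. **Proposition.** Let $X$ and $X^{(n)}$, $n\in\mathbb{N}$, be $d$-dimensional additive processes (possibly on different probability spaces) with systems of characteristic triplets $(\gamma_t,A_t,\nu_t)_{t\ge0}$ and $(\gamma^{(n)}_t,A^{(n)}_t,\nu^{(n)}_t)_{t\ge0}$, and modified second characteristics $\tilde A_t$ and $\tilde A^{(n)}_t$. Suppose that $\lim_{n\to\infty}|\tilde A^{(n)}_t-\tilde A_t|=0$ for every $t>0$. Then $$\lim_{n\to\infty}\sup_{t\in[0,T]}\bigl|\tilde A^{(n)}_t-\tilde A_t\bigr|=0\quad\text{for every }T>0.$$ If, moreover, $\lim_{n\to\infty}\int f\,d\nu^{(n)}_t=\int f\,d\nu_t$ for every $t>0$ and every $f\in C_\sharp(\mathbb{R}^d)$, then $$\lim_{n\to\infty}\sup_{t\in[0,T]}\Bigl|\int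 f\,d\nu^{(n)}_t-\int f\,d\nu_t\Bigr|=0\quad\text{for every }T>0\text{ and every }f\in C_{\sharp\sharp}(\mathbb{R}^d).$$ -/

import Mathlib

open MeasureTheory ProbabilityTheory Filter Topology
open scoped NNReal ENNReal Matrix BoundedContinuousFunction

namespace AdditiveProcess

/-- A `d`-dimensional additive process on `(Ω, P)`, indexed by `t ∈ [0, ∞)`. -/
structure IsAdditive {d : ℕ} {Ω : Type*} [MeasurableSpace Ω]
    (X : ℝ≥0 → Ω → EuclideanSpace ℝ (Fin d)) (P : Measure Ω) : Prop where
  measurable : ∀ t, Measurable (X t)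
  zero : ∀ᵐ ω ∂P, X 0 ω = 0
  /-- stochastic continuity -/
  stochCont : ∀ (t₀ : ℝ≥0) (ε : ℝ), 0 < ε →
    Tendsto (fun t => P {ω | ε ≤ ‖X t ω - X t₀ ω‖}) (𝓝 t₀) (𝓝 0)
  /-- almost every path is right-continuous with left limits -/
  cadlag : ∀ᵐ ω ∂P, ∀ t : ℝ≥0,
    ContinuousWithinAt (fun s => X s ω) (Set.Ici t) t ∧
      ∃ l, Tendsto (fun s => X s ω) (𝓝[<] t) (𝓝 l)
  indepIncrements : HasIndepIncrements X P

/-- A truncation function: bounded, continuous, and equal to the identity near the origin. -/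
structure IsTruncation {d : ℕ} (h : EuclideanSpace ℝ (Fin d) → EuclideanSpace ℝ (Fin d)) :
    Prop where
  continuous : Continuous h
  bounded : ∃ C : ℝ, ∀ x, ‖h x‖ ≤ C
  eq_self : ∀ᶠ x in 𝓝 0, h x = x

/-- A Lévy measure: no mass at the origin, and `∫ min(|x|², 1) dν < ∞`. -/
structure IsLevyMeasure {d : ℕ} (ν : Measure (EuclideanSpace ℝ (Fin d))) : Prop where
  zero : ν {0} = 0
  lintegral_lt_top : ∫⁻ x, ENNReal.ofReal (min (‖x‖ ^ 2) 1) ∂ν < ∞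

/-- The Lévy symbol
`i ξ·γ - (1/2) ξ·Aξ + ∫_{x ≠ 0} (exp(i ξ·x) - 1 - i ξ·h(x)) ν(dx)`. -/
noncomputable def levySymbol {d : ℕ}
    (h : EuclideanSpace ℝ (Fin d) → EuclideanSpace ℝ (Fin d))
    (γ : EuclideanSpace ℝ (Fin d)) (A : Matrix (Fin d) (Fin d) ℝ)
    (ν : Measure (EuclideanSpace ℝ (Fin d))) (ξ : EuclideanSpace ℝ (Fin d)) : ℂ :=
  Complex.I * ((inner ℝ ξ γ : ℝ) : ℂ) - (1 / 2 : ℂ) * ((ξ.ofLp ⬝ᵥ (A *ᵥ ξ.ofLp) : ℝ) : ℂ) +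
    ∫ x in {0}ᶜ, (Complex.exp (Complex.I * ((inner ℝ ξ x : ℝ) : ℂ)) - 1
      - Complex.I * ((inner ℝ ξ (h x) : ℝ) : ℂ)) ∂ν

/-- `(γ_t, A_t, ν_t)_{t ≥ 0}` is the system of characteristic triplets of `X`, relative to the
truncation function `h`: for every `t`, the matrix `A_t` is symmetric and non-negative definite,
`ν_t` is a Lévy measure, and the law of `X_t` has the Lévy-Khintchine representation with triplet
`(γ_t, A_t, ν_t)`. Monotonicity and continuity in `t` are not part of the definition. -/
structure IsCharTriplets {d : ℕ} {Ω : Type*} [MeasurableSpace Ω]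
    (h : EuclideanSpace ℝ (Fin d) → EuclideanSpace ℝ (Fin d))
    (X : ℝ≥0 → Ω → EuclideanSpace ℝ (Fin d)) (P : Measure Ω)
    (γ : ℝ≥0 → EuclideanSpace ℝ (Fin d)) (A : ℝ≥0 → Matrix (Fin d) (Fin d) ℝ)
    (ν : ℝ≥0 → Measure (EuclideanSpace ℝ (Fin d))) : Prop where
  posSemidef : ∀ t, (A t).PosSemidef
  levy : ∀ t, IsLevyMeasure (ν t)
  charFun_eq : ∀ t ξ, charFun (P.map (X t)) ξ = Complex.exp (levySymbol h (γ t) (A t) (ν t) ξ)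

/-- The modified second characteristic, with entries `A_{jk} + ∫ h_j h_k dν`. -/
noncomputable def modSecondChar {d : ℕ}
    (h : EuclideanSpace ℝ (Fin d) → EuclideanSpace ℝ (Fin d))
    (A : Matrix (Fin d) (Fin d) ℝ) (ν : Measure (EuclideanSpace ℝ (Fin d))) :
    Matrix (Fin d) (Fin d) ℝ :=
  Matrix.of fun j k => A j k + ∫ x, h x j * h x k ∂ν

/-- Bounded continuous functions vanishing on a neighborhood of the origin. -/
def CSharp (d : ℕ) : Set (EuclideanSpace ℝ (Fin d) →ᵇ ℝ) :=
  {f | ∀ᶠ x in 𝓝 0, f x = 0}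

/-- Bounded continuous functions with `f(x) / |x|² → 0` as `x → 0`. -/
def CSharpSharp (d : ℕ) : Set (EuclideanSpace ℝ (Fin d) →ᵇ ℝ) :=
  {f | Tendsto (fun x => f x / ‖x‖ ^ 2) (𝓝[≠] 0) (𝓝 0)}

end AdditiveProcess

/-! Pointwise convergence of monotone functions to a continuous limit is locally uniform
(`tendstoUniformlyOn_of_monotone`). The work lies in showing that `t ↦ v · Ã_t v` and `t ↦ ∫ g
dν_t`, for `0 ≤ g ≤ C min(|x|², 1)`, are monotone and continuous, although the triplets are only
given through the law of each `X_t`.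

Monotonicity. With `ψ_t` the Lévy symbol, the second difference `2ψ_t(ξ) - ψ_t(ξ+u) - ψ_t(ξ-u)` is
the characteristic function of the finite measure `(u · A_t u) δ₀ + 2(1 - cos(u·x)) ν_t(dx)`. For
the law `μ` of a small increment, with characteristic function `φ`, the corresponding quantity is
`φ(ξ)² - φ(ξ+u) φ(ξ-u)`, again the characteristic function of a positive measure (`pairMeasure`).
Summed over fine partitions of `[s, t]`, these converge to the increment of the second difference,
so Lévy's continuity theorem gives `diffMeasure_mono`. The atom at the origin then gives
monotonicity of `A_t`, and division by the density that of `ν_t`.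

Continuity. Stochastic continuity makes `ψ_t(ξ)` continuous in `t`. At `ξ = 0` the second difference
is a sum of two monotone functions, so both are continuous. Averaging `1 - cos(u·x)` over Gaussian
`u` gives an integrand comparable to `min(|x|², 1)`, and domination of increments reaches every `g`.

Polarization passes from quadratic forms to matrix entries. For `f` in `CSharpSharp`, pointwise
convergence follows by cutting `f` off near the origin, with an error controlled by the trace of
`Ã`; positive and negative parts are then treated separately. -/

namespace AdditiveProcess

/-! ### Weak limits and positivity of differences of finite measures -/

section Weak

variable {E : Type*} [NormedAddCommGroup E] [InnerProductSpace ℝ E] [FiniteDimensional ℝ E]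
  [MeasurableSpace E] [BorelSpace E]

/-- Lévy's continuity theorem for finite measures with a nonzero limit. -/
theorem tendsto_finiteMeasure_of_tendsto_charFun {κ : ℕ → FiniteMeasure E} {κ₀ : FiniteMeasure E}
    (h0 : κ₀ ≠ 0)
    (h : ∀ ξ, Tendsto (fun n => charFun (κ n : Measure E) ξ) atTop
      (𝓝 (charFun (κ₀ : Measure E) ξ))) :
    Tendsto κ atTop (𝓝 κ₀) := by
  -- The value of a characteristic function at `0` is the total mass.
  have hmass : Tendsto (fun n => (κ n).mass) atTop (𝓝 κ₀.mass) := by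
    have := h 0
    simp only [charFun_zero] at this
    have h2 := (Complex.continuous_re.tendsto _).comp this
    rw [← NNReal.tendsto_coe]
    exact h2
  have hne : ∀ᶠ n in atTop, κ n ≠ 0 := by
    have : ∀ᶠ n in atTop, (κ n).mass ≠ 0 :=
      hmass.eventually_ne ((FiniteMeasure.mass_nonzero_iff _).2 h0)
    filter_upwards [this] with n hn using (FiniteMeasure.mass_nonzero_iff _).1 hn
  have hchar : ∀ (μ : FiniteMeasure E), μ ≠ 0 → ∀ ξ, charFun (μ.normalize : Measure E) ξ =
      ((μ.mass⁻¹ : ℝ≥0) : ℝ) • charFun (μ : Measure E) ξ := by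
    intro μ hμ ξ
    have := FiniteMeasure.toMeasure_normalize_eq_of_nonzero μ hμ
    rw [this, charFun_apply, charFun_apply, integral_smul_nnreal_measure]
    rfl
  refine FiniteMeasure.tendsto_of_tendsto_normalize_testAgainstNN_of_tendsto_mass ?_ hmass
  refine ProbabilityMeasure.tendsto_of_tendsto_charFun fun ξ => ?_
  rw [hchar _ h0]
  have hm : Tendsto (fun n => (((κ n).mass⁻¹ : ℝ≥0) : ℝ) • charFun (κ n : Measure E) ξ) atTop
      (𝓝 (((κ₀.mass⁻¹ : ℝ≥0) : ℝ) • charFun (κ₀ : Measure E) ξ)) :=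
    (NNReal.tendsto_coe.2 (hmass.inv₀ ((FiniteMeasure.mass_nonzero_iff _).2 h0))).smul (h ξ)
  refine hm.congr' ?_
  filter_upwards [hne] with n hn
  rw [hchar _ hn]

theorem le_of_forall_isClosed_le {μ ν : Measure E} [IsFiniteMeasure μ] [IsFiniteMeasure ν]
    (h : ∀ F, IsClosed F → μ F ≤ ν F) : μ ≤ ν := by
  rw [Measure.le_iff]
  intro s hs
  rw [hs.measure_eq_iSup_isClosed_of_ne_top (measure_ne_top μ s)]
  exact iSup₂_le fun K hK => iSup_le fun hKc => (h K hKc).trans (measure_mono hK)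

/-- If the difference of two characteristic functions is a pointwise limit of characteristic
functions of finite measures, then the corresponding signed measure is nonnegative. -/
theorem le_of_tendsto_charFun {N₁ N₂ : Measure E} [IsFiniteMeasure N₁] [IsFiniteMeasure N₂]
    {M : ℕ → Measure E} [∀ n, IsFiniteMeasure (M n)]
    (h : ∀ ξ, Tendsto (fun n => charFun (M n) ξ) atTop (𝓝 (charFun N₂ ξ - charFun N₁ ξ))) :
    N₁ ≤ N₂ := by
  have hadd : ∀ n ξ, charFun (M n + N₁) ξ = charFun (M n) ξ + charFun N₁ ξ := by
    intro n ξ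
    have hi : ∀ μ : Measure E, IsFiniteMeasure μ →
        Integrable (fun x : E => Complex.exp ((inner ℝ x ξ : ℝ) * Complex.I)) μ := by
      intro μ _
      refine Integrable.of_bound (C := 1) (by fun_prop) (ae_of_all _ fun x => ?_)
      rw [Complex.norm_exp_ofReal_mul_I]
    rw [charFun_apply, charFun_apply, charFun_apply,
      integral_add_measure (hi _ inferInstance) (hi _ inferInstance)]
  have hlim : ∀ ξ, Tendsto (fun n => charFun (M n + N₁) ξ) atTop (𝓝 (charFun N₂ ξ)) := by
    intro ξ
    simp only [hadd]
    simpa using (h ξ).add_const (charFun N₁ ξ)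
  -- The continuity theorem normalizes the limit, so a zero limit is settled by comparing masses.
  by_cases hN : N₂ = 0
  · subst hN
    have h0 := hlim 0
    simp only [charFun_zero] at h0
    have h1 := (Complex.continuous_re.tendsto _).comp h0
    have h2 : Tendsto (fun n => (M n + N₁).real Set.univ) atTop (𝓝 0) := by
      simpa [Function.comp_def] using h1
    have h3 : N₁.real Set.univ ≤ 0 := by
      refine ge_of_tendsto h2 (Eventually.of_forall fun n => ?_)
      rw [measureReal_add_apply]
      linarith [measureReal_nonneg (μ := M n) (s := Set.univ)]
    have h4 : N₁ Set.univ = 0 := by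
      have := le_antisymm h3 measureReal_nonneg
      rwa [measureReal_eq_zero_iff] at this
    rw [Measure.measure_univ_eq_zero.1 h4]
  · let κ₀ : FiniteMeasure E := ⟨N₂, inferInstance⟩
    have hN' : κ₀ ≠ 0 := by
      intro h0
      exact hN (congrArg (fun μ : FiniteMeasure E => (μ : Measure E)) h0)
    have ht := tendsto_finiteMeasure_of_tendsto_charFun
      (κ := fun n => ⟨M n + N₁, inferInstance⟩) hN' hlim
    refine le_of_forall_isClosed_le fun F hF => ?_
    -- Portmanteau: `N₁ F ≤ (M n + N₁) F` for every `n`, and the limsup of the right side is at most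
    -- `N₂ F`.
    refine le_trans ?_ (FiniteMeasure.limsup_measure_closed_le_of_tendsto ht hF)
    refine le_limsup_of_frequently_le (Frequently.of_forall fun n => ?_)
    simp

end Weak

/-! ### Pólya's theorem and the choice of branch of the logarithm -/

/-- **Pólya's theorem**: pointwise convergence of monotone functions to a continuous function
is locally uniform. -/
theorem tendstoUniformlyOn_of_monotone {f : ℕ → ℝ≥0 → ℝ} {g : ℝ≥0 → ℝ}
    (hf : ∀ n, Monotone (f n)) (hg : Continuous g)
    (h : ∀ t, Tendsto (fun n => f n t) atTop (𝓝 (g t))) (T : ℝ≥0) :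
    TendstoUniformlyOn f g atTop (Set.Icc 0 T) := by
  have hgm : Monotone g := fun s t hst =>
    le_of_tendsto_of_tendsto' (h s) (h t) fun n => hf n hst
  rw [← tendstoLocallyUniformlyOn_iff_tendstoUniformlyOn_of_compact isCompact_Icc]
  refine TendstoLocallyUniformly.tendstoLocallyUniformlyOn ?_
  rw [Metric.tendstoLocallyUniformly_iff]
  intro ε hε t₀
  -- On `[a, b]`, `f n t` lies between endpoint values within `ε / 2` of `g t₀`, and `g t` lies
  -- within `ε / 4` of it.
  obtain ⟨a, b, hab, hnhds, hsub⟩ := exists_Icc_mem_subset_of_mem_nhds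
    (hg.continuousAt.preimage_mem_nhds (Metric.ball_mem_nhds (g t₀) (show 0 < ε / 4 by positivity)))
  refine ⟨Set.Icc a b, hnhds, ?_⟩
  have hab' : a ≤ b := hab.1.trans hab.2
  have ha := hsub (Set.left_mem_Icc.2 hab')
  have hb := hsub (Set.right_mem_Icc.2 hab')
  simp only [Set.mem_preimage, Metric.mem_ball, Real.dist_eq, abs_lt] at ha hb
  filter_upwards [(h a).eventually (Metric.ball_mem_nhds _ (show 0 < ε / 4 by positivity)),
    (h b).eventually (Metric.ball_mem_nhds _ (show 0 < ε / 4 by positivity))] with n hna hnb t ht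
  simp only [Real.dist_eq, abs_lt] at hna hnb
  rw [Real.dist_eq, abs_lt]
  have := hf n ht.1
  have := hf n ht.2
  have := hgm ht.1
  have := hgm ht.2
  constructor <;> linarith

/-- A continuous lift of a path staying close to `1` is the principal logarithm. -/
theorem eq_log_exp_of_continuousOn {f : ℝ → ℂ} (hf : ContinuousOn f (Set.Icc 0 1)) (h0 : f 0 = 0)
    (h1 : ∀ r ∈ Set.Icc (0 : ℝ) 1, ‖Complex.exp (f r) - 1‖ < 1) :
    f 1 = Complex.log (Complex.exp (f 1)) := by
  have hslit : ∀ r ∈ Set.Icc (0 : ℝ) 1, Complex.exp (f r) ∈ Complex.slitPlane := by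
    intro r hr
    have := Complex.mem_slitPlane_of_norm_lt_one (h1 r hr)
    simpa using this
  -- `g` counts the multiples of `2πi` separating `f` from the principal logarithm. It is continuous
  -- and integer valued, and a nonzero value at `1` would force a value `±1/2` in between.
  let g : ℝ → ℝ := fun r => (f r - Complex.log (Complex.exp (f r))).im / (2 * Real.pi)
  have hg : ContinuousOn g (Set.Icc 0 1) := by
    refine (Complex.continuous_im.comp_continuousOn (hf.sub ?_)).div_const _
    exact ContinuousOn.clog (Complex.continuous_exp.comp_continuousOn hf) hslit
  have hk : ∀ r, ∃ k : ℤ, f r - Complex.log (Complex.exp (f r)) = k * (2 * Real.pi * Complex.I) := by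
    intro r
    have : Complex.exp (f r) = Complex.exp (Complex.log (Complex.exp (f r))) :=
      (Complex.exp_log (Complex.exp_ne_zero _)).symm
    obtain ⟨k, hk⟩ := Complex.exp_eq_exp_iff_exists_int.1 this
    exact ⟨k, by linear_combination hk⟩
  have hgk : ∀ r, ∃ k : ℤ, g r = k := by
    intro r
    obtain ⟨k, hk⟩ := hk r
    refine ⟨k, ?_⟩
    have hpi := Real.pi_ne_zero
    simp only [g, hk]
    simp
  have hg0 : g 0 = 0 := by simp [g, h0]
  have hg1 : g 1 = 0 := by
    by_contra hne
    have hoc : (g '' Set.Icc 0 1).OrdConnected :=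
      ((isPreconnected_Icc.image g hg).ordConnected)
    obtain ⟨k, hk1⟩ := hgk 1
    have hmem0 : g 0 ∈ g '' Set.Icc (0 : ℝ) 1 := ⟨0, by simp, rfl⟩
    have hmem1 : g 1 ∈ g '' Set.Icc (0 : ℝ) 1 := ⟨1, by simp, rfl⟩
    have hk0 : k ≠ 0 := by rintro rfl; simp [hk1] at hne
    rcases lt_or_gt_of_ne hk0 with hk' | hk'
    · have hle : (k : ℝ) ≤ -1 := by exact_mod_cast (by omega : k ≤ -1)
      obtain ⟨r, -, hr⟩ := hoc.out hmem1 hmem0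
        (show (-(1/2) : ℝ) ∈ Set.Icc (g 1) (g 0) by rw [hk1, hg0]; constructor <;> linarith)
      obtain ⟨m, hm⟩ := hgk r
      have h2 : (2 * m : ℝ) = -1 := by linarith
      have : (2 * m : ℤ) = -1 := by exact_mod_cast h2
      omega
    · have hle : (1 : ℝ) ≤ k := by exact_mod_cast hk'
      obtain ⟨r, -, hr⟩ := hoc.out hmem0 hmem1
        (show (1/2 : ℝ) ∈ Set.Icc (g 0) (g 1) by rw [hk1, hg0]; constructor <;> linarith)
      obtain ⟨m, hm⟩ := hgk r
      have h2 : (2 * m : ℝ) = 1 := by linarith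
      have : (2 * m : ℤ) = 1 := by exact_mod_cast h2
      omega
  obtain ⟨k, hk1⟩ := hk 1
  have hk0 : k = 0 := by
    have hpi := Real.pi_ne_zero
    have : g 1 = k := by
      simp only [g, hk1]
      simp
    rw [hg1] at this
    exact_mod_cast this.symm
  rw [hk0] at hk1
  simpa [sub_eq_zero] using hk1

/-! ### The Lévy symbol and its second differences -/

section LevySymbol

variable {d : ℕ} {ν : Measure (EuclideanSpace ℝ (Fin d))}
  {h : EuclideanSpace ℝ (Fin d) → EuclideanSpace ℝ (Fin d)}

theorem IsLevyMeasure.integrable_min (hν : IsLevyMeasure ν) :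
    Integrable (fun x => min (‖x‖ ^ 2) 1) ν := by
  refine ⟨by fun_prop, ?_⟩
  rw [hasFiniteIntegral_iff_ofReal (ae_of_all _ fun x => by positivity)]
  exact hν.lintegral_lt_top

theorem IsLevyMeasure.integrable_of_norm_le {F : Type*} [NormedAddCommGroup F] [NormedSpace ℝ F]
    (hν : IsLevyMeasure ν) {g : EuclideanSpace ℝ (Fin d) → F} (hg : AEStronglyMeasurable g ν)
    (C : ℝ) (hC : ∀ x, ‖g x‖ ≤ C * min (‖x‖ ^ 2) 1) : Integrable g ν :=
  (hν.integrable_min.const_mul C).mono' hg (ae_of_all _ hC)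

theorem IsLevyMeasure.restrict_compl_zero (hν : IsLevyMeasure ν) : ν.restrict {0}ᶜ = ν := by
  refine Measure.restrict_eq_self_of_ae_mem ?_
  rw [ae_iff]
  simpa using hν.zero

theorem norm_exp_I_sub_one_sub_le (y : ℝ) :
    ‖Complex.exp (Complex.I * y) - 1 - Complex.I * y‖ ≤ 3 * y ^ 2 := by
  by_cases hy : |y| ≤ 1
  · have h1 : ‖Complex.I * (y : ℂ)‖ = |y| := by simp
    have := Complex.norm_exp_sub_one_sub_id_le (x := Complex.I * y) (by rw [h1]; exact hy)
    rw [h1, sq_abs] at this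
    nlinarith [sq_nonneg y]
  · push Not at hy
    have h1 : ‖Complex.exp (Complex.I * (y : ℂ)) - 1‖ ≤ |y| :=
      Real.norm_exp_I_mul_ofReal_sub_one_le
    have h2 : ‖Complex.I * (y : ℂ)‖ = |y| := by simp
    refine (norm_sub_le _ _).trans ?_
    rw [h2, ← sq_abs]
    nlinarith

/-- The compensated exponential is dominated by `min (‖x‖²) 1`, locally uniformly in `ξ`. -/
theorem IsTruncation.exists_norm_le (hh : IsTruncation h) (R : ℝ) : ∃ C : ℝ, 0 ≤ C ∧
    ∀ ξ : EuclideanSpace ℝ (Fin d), ‖ξ‖ ≤ R → ∀ x,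
    ‖Complex.exp (Complex.I * ((inner ℝ ξ x : ℝ) : ℂ)) - 1
      - Complex.I * ((inner ℝ ξ (h x) : ℝ) : ℂ)‖ ≤ C * min (‖x‖ ^ 2) 1 := by
  obtain ⟨K, hK⟩ := hh.bounded
  have hK0 : 0 ≤ K := (norm_nonneg _).trans (hK 0)
  obtain ⟨δ, hδ, hball⟩ := Metric.eventually_nhds_iff.1 hh.eq_self
  let η := min δ 1
  have hη : 0 < η := lt_min hδ one_pos
  -- The first term serves `‖x‖ < η`, where `h x = x` and a second-order bound applies; the second
  -- serves `‖x‖ ≥ η`, where the expression is at most `2 + |R| * K` and the minimum at least `η ^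
  -- 2`.
  let C := 3 * R ^ 2 + (2 + |R| * K) / η ^ 2
  have hC0 : 0 ≤ (2 + |R| * K) / η ^ 2 := by positivity
  refine ⟨C, by positivity, fun ξ hξ x => ?_⟩
  have hR : |R| = R := abs_of_nonneg ((norm_nonneg _).trans hξ)
  by_cases hx : ‖x‖ < η
  · have hx1 : ‖x‖ ≤ 1 := (hx.le.trans (min_le_right _ _))
    have hhx : h x = x := hball (by simpa using hx.trans_le (min_le_left _ _))
    rw [hhx, min_eq_left (by nlinarith [norm_nonneg x])]
    refine (norm_exp_I_sub_one_sub_le _).trans ?_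
    have h1 : (inner ℝ ξ x) ^ 2 ≤ (R * ‖x‖) ^ 2 := by
      rw [← sq_abs (inner ℝ ξ x)]
      refine pow_le_pow_left₀ (abs_nonneg _) ((abs_real_inner_le_norm ξ x).trans ?_) 2
      gcongr
    simp only [C]
    nlinarith [mul_nonneg hC0 (sq_nonneg ‖x‖)]
  · push Not at hx
    have hmin : η ^ 2 ≤ min (‖x‖ ^ 2) 1 := by
      refine le_min (pow_le_pow_left₀ hη.le hx 2) ?_
      have : η ≤ 1 := min_le_right _ _
      nlinarith
    have h1 : ‖Complex.exp (Complex.I * ((inner ℝ ξ x : ℝ) : ℂ))‖ = 1 := by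
      rw [mul_comm]; exact Complex.norm_exp_ofReal_mul_I _
    have h2 : ‖Complex.I * ((inner ℝ ξ (h x) : ℝ) : ℂ)‖ ≤ |R| * K := by
      rw [norm_mul, Complex.norm_I, one_mul, Complex.norm_real, Real.norm_eq_abs, hR]
      refine (abs_real_inner_le_norm _ _).trans ?_
      exact mul_le_mul hξ (hK x) (norm_nonneg _) ((norm_nonneg _).trans hξ)
    calc _ ≤ 1 + 1 + |R| * K := by
          refine (norm_sub_le _ _).trans (add_le_add ((norm_sub_le _ _).trans ?_) h2)
          rw [h1]; simp
      _ = (2 + |R| * K) / η ^ 2 * η ^ 2 := by field_simp; ring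
      _ ≤ (2 + |R| * K) / η ^ 2 * min (‖x‖ ^ 2) 1 := by gcongr
      _ ≤ C * min (‖x‖ ^ 2) 1 := by
          have : 0 ≤ min (‖x‖ ^ 2) 1 := by positivity
          gcongr
          simp only [C]
          nlinarith [sq_nonneg R]

theorem IsTruncation.integrable_compensated (hh : IsTruncation h) (hν : IsLevyMeasure ν)
    (ξ : EuclideanSpace ℝ (Fin d)) :
    Integrable (fun x => Complex.exp (Complex.I * ((inner ℝ ξ x : ℝ) : ℂ)) - 1
      - Complex.I * ((inner ℝ ξ (h x) : ℝ) : ℂ)) ν := by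
  obtain ⟨C, -, hC⟩ := hh.exists_norm_le ‖ξ‖
  have := hh.continuous
  exact hν.integrable_of_norm_le (by fun_prop) C (hC ξ le_rfl)

theorem continuous_levySymbol (hh : IsTruncation h) (hν : IsLevyMeasure ν)
    (γ : EuclideanSpace ℝ (Fin d)) (A : Matrix (Fin d) (Fin d) ℝ) :
    Continuous (levySymbol h γ A ν) := by
  have := hh.continuous
  unfold levySymbol
  refine Continuous.add (by fun_prop) ?_
  rw [hν.restrict_compl_zero, continuous_iff_continuousAt]
  intro ξ₀
  obtain ⟨C, -, hC⟩ := hh.exists_norm_le (‖ξ₀‖ + 1)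
  refine continuousAt_of_dominated (bound := fun x => C * min (‖x‖ ^ 2) 1)
    (Eventually.of_forall fun ξ => by fun_prop) ?_ (hν.integrable_min.const_mul C)
    (ae_of_all _ fun x => by fun_prop)
  have : ∀ᶠ ξ in 𝓝 ξ₀, ‖ξ‖ < ‖ξ₀‖ + 1 :=
    continuous_norm.continuousAt.eventually_lt_const (by simp)
  filter_upwards [this] with ξ hξ using ae_of_all _ (hC ξ hξ.le)

@[simp]
theorem levySymbol_zero (γ : EuclideanSpace ℝ (Fin d)) (A : Matrix (Fin d) (Fin d) ℝ) :
    levySymbol h γ A ν 0 = 0 := by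
  simp [levySymbol]

theorem one_sub_cos_le (u x : EuclideanSpace ℝ (Fin d)) :
    1 - Real.cos (inner ℝ u x) ≤ (‖u‖ ^ 2 + 2) * min (‖x‖ ^ 2) 1 := by
  rcases le_total (‖x‖ ^ 2) 1 with hx | hx
  · rw [min_eq_left hx]
    have h1 := Real.one_sub_sq_div_two_le_cos (x := inner ℝ u x)
    have h2 : (inner ℝ u x) ^ 2 ≤ (‖u‖ * ‖x‖) ^ 2 := by
      rw [← sq_abs (inner ℝ u x)]
      exact pow_le_pow_left₀ (abs_nonneg _) (abs_real_inner_le_norm u x) 2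
    nlinarith [sq_nonneg ‖x‖, sq_nonneg (‖u‖ * ‖x‖)]
  · rw [min_eq_right hx]
    nlinarith [Real.neg_one_le_cos (inner ℝ u x), sq_nonneg ‖u‖]

theorem IsLevyMeasure.integrable_one_sub_cos (hν : IsLevyMeasure ν)
    (u : EuclideanSpace ℝ (Fin d)) : Integrable (fun x => 1 - Real.cos (inner ℝ u x)) ν := by
  refine hν.integrable_of_norm_le (by fun_prop) (‖u‖ ^ 2 + 2) fun x => ?_
  rw [Real.norm_of_nonneg (by linarith [Real.cos_le_one (inner ℝ u x)])]
  exact one_sub_cos_le u x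

/-- The finite measure whose characteristic function is the second difference
`2 ψ(ξ) - ψ(ξ + u) - ψ(ξ - u)` of the Lévy symbol `ψ` with triplet `(γ, A, ν)`. -/
noncomputable def diffMeasure (A : Matrix (Fin d) (Fin d) ℝ)
    (ν : Measure (EuclideanSpace ℝ (Fin d))) (u : EuclideanSpace ℝ (Fin d)) :
    Measure (EuclideanSpace ℝ (Fin d)) :=
  ENNReal.ofReal (u.ofLp ⬝ᵥ (A *ᵥ u.ofLp)) • Measure.dirac 0 +
    ν.withDensity fun x => ENNReal.ofReal (2 * (1 - Real.cos (inner ℝ u x)))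

theorem isFiniteMeasure_diffMeasure (hν : IsLevyMeasure ν) (A : Matrix (Fin d) (Fin d) ℝ)
    (u : EuclideanSpace ℝ (Fin d)) : IsFiniteMeasure (diffMeasure A ν u) := by
  have h1 : IsFiniteMeasure
      (ν.withDensity fun x => ENNReal.ofReal (2 * (1 - Real.cos (inner ℝ u x)))) :=
    isFiniteMeasure_withDensity_ofReal ((hν.integrable_one_sub_cos u).const_mul 2).2
  have h2 : IsFiniteMeasure (ENNReal.ofReal (u.ofLp ⬝ᵥ (A *ᵥ u.ofLp)) •
      (Measure.dirac 0 : Measure (EuclideanSpace ℝ (Fin d)))) :=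
    Measure.smul_finite _ ENNReal.ofReal_ne_top
  unfold diffMeasure
  infer_instance

theorem integral_diffMeasure {F : Type*} [NormedAddCommGroup F] [NormedSpace ℝ F] [CompleteSpace F]
    (hν : IsLevyMeasure ν) {A : Matrix (Fin d) (Fin d) ℝ} (hA : A.PosSemidef)
    (u : EuclideanSpace ℝ (Fin d)) {g : EuclideanSpace ℝ (Fin d) → F} (hg : Continuous g) (K : ℝ)
    (hK : ∀ x, ‖g x‖ ≤ K) :
    ∫ x, g x ∂(diffMeasure A ν u) = (u.ofLp ⬝ᵥ (A *ᵥ u.ofLp)) • g 0 +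
      ∫ x, (2 * (1 - Real.cos (inner ℝ u x))) • g x ∂ν := by
  have hfin := isFiniteMeasure_diffMeasure hν A u
  have hi : Integrable g (diffMeasure A ν u) :=
    Integrable.of_bound hg.aestronglyMeasurable K (ae_of_all _ hK)
  unfold diffMeasure at hi ⊢
  rw [integral_add_measure hi.left_of_add_measure hi.right_of_add_measure, integral_smul_measure,
    integral_dirac, ENNReal.toReal_ofReal (by simpa using hA.dotProduct_mulVec_nonneg u.ofLp),
    integral_withDensity_eq_integral_toReal_smul (by fun_prop)
      (ae_of_all _ fun x => ENNReal.ofReal_lt_top)]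
  congr 1
  refine integral_congr_ae (ae_of_all _ fun x => ?_)
  simp only
  rw [ENNReal.toReal_ofReal (by linarith [Real.cos_le_one (inner ℝ u x)])]

/-- Drift and compensator are affine in `ξ` and cancel in the second difference. The parallelogram
law leaves `u · A u`, and `2 - e^{iu·x} - e^{-iu·x} = 2(1 - cos(u·x))`. -/
theorem charFun_diffMeasure (hh : IsTruncation h) (hν : IsLevyMeasure ν)
    (γ : EuclideanSpace ℝ (Fin d)) {A : Matrix (Fin d) (Fin d) ℝ} (hA : A.PosSemidef)
    (u ξ : EuclideanSpace ℝ (Fin d)) :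
    charFun (diffMeasure A ν u) ξ =
      2 * levySymbol h γ A ν ξ - levySymbol h γ A ν (ξ + u) - levySymbol h γ A ν (ξ - u) := by
  rw [charFun_apply, integral_diffMeasure hν hA u (by fun_prop) 1
    (fun x => by rw [Complex.norm_exp_ofReal_mul_I])]
  unfold levySymbol
  rw [hν.restrict_compl_zero]
  have h0 := hh.integrable_compensated hν ξ
  have h1 := hh.integrable_compensated hν (ξ + u)
  have h2 := hh.integrable_compensated hν (ξ - u)
  have hint : ∫ x, (2 * (1 - Real.cos (inner ℝ u x))) • Complex.exp ((inner ℝ x ξ : ℝ) * Complex.I) ∂ν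
      = 2 * (∫ x, (Complex.exp (Complex.I * ((inner ℝ ξ x : ℝ) : ℂ)) - 1
          - Complex.I * ((inner ℝ ξ (h x) : ℝ) : ℂ)) ∂ν)
        - (∫ x, (Complex.exp (Complex.I * ((inner ℝ (ξ + u) x : ℝ) : ℂ)) - 1
          - Complex.I * ((inner ℝ (ξ + u) (h x) : ℝ) : ℂ)) ∂ν)
        - ∫ x, (Complex.exp (Complex.I * ((inner ℝ (ξ - u) x : ℝ) : ℂ)) - 1
          - Complex.I * ((inner ℝ (ξ - u) (h x) : ℝ) : ℂ)) ∂ν := by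
    rw [← integral_const_mul, ← integral_sub (h0.const_mul 2) h1]
    refine Eq.trans ?_ (integral_sub ((h0.const_mul 2).sub h1) h2)
    refine integral_congr_ae (ae_of_all _ fun x => ?_)
    simp only [inner_add_left, inner_sub_left, Complex.ofReal_add, Complex.ofReal_sub, mul_add,
      mul_sub, Complex.exp_add, Complex.exp_sub, Complex.real_smul, Complex.ofReal_mul,
      Complex.ofReal_one, Complex.ofReal_cos, Complex.cos, Complex.ofReal_ofNat,
      real_inner_comm ξ x, neg_mul, Complex.exp_neg]
    rw [mul_comm Complex.I ((inner ℝ ξ x : ℝ) : ℂ), mul_comm Complex.I ((inner ℝ u x : ℝ) : ℂ)]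
    have := Complex.exp_ne_zero (((inner ℝ u x : ℝ) : ℂ) * Complex.I)
    field_simp
    ring
  rw [hint]
  have hq : ((ξ + u).ofLp ⬝ᵥ (A *ᵥ (ξ + u).ofLp)) + ((ξ - u).ofLp ⬝ᵥ (A *ᵥ (ξ - u).ofLp)) =
      2 * (ξ.ofLp ⬝ᵥ (A *ᵥ ξ.ofLp)) + 2 * (u.ofLp ⬝ᵥ (A *ᵥ u.ofLp)) := by
    simp only [WithLp.ofLp_add, WithLp.ofLp_sub, Matrix.mulVec_add, Matrix.mulVec_sub,
      add_dotProduct, sub_dotProduct, dotProduct_add, dotProduct_sub]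
    ring
  have hq' := congrArg (fun r : ℝ => (r : ℂ)) hq
  simp only [Complex.ofReal_add, Complex.ofReal_mul, Complex.ofReal_ofNat] at hq'
  simp only [inner_zero_left, Complex.ofReal_zero, zero_mul, Complex.exp_zero, inner_add_left,
    inner_sub_left, Complex.ofReal_add, Complex.ofReal_sub, Complex.real_smul]
  linear_combination (-1 / 2 : ℂ) * hq'

end LevySymbol

/-! ### Continuity in time of the symbol, and the law of an increment -/

section Paths

variable {d : ℕ} {Ω : Type*} [MeasurableSpace Ω] {P : Measure Ω} [IsProbabilityMeasure P]
  {X : ℝ≥0 → Ω → EuclideanSpace ℝ (Fin d)}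
  {h : EuclideanSpace ℝ (Fin d) → EuclideanSpace ℝ (Fin d)}
  {γ : ℝ≥0 → EuclideanSpace ℝ (Fin d)} {A : ℝ≥0 → Matrix (Fin d) (Fin d) ℝ}
  {ν : ℝ≥0 → Measure (EuclideanSpace ℝ (Fin d))}

/-- Where `‖Y - Z‖ < ε` the integrands differ by at most `‖ξ‖ * ε`; elsewhere by at most `2`. -/
theorem norm_charFun_map_sub_le {Y Z : Ω → EuclideanSpace ℝ (Fin d)} (hY : Measurable Y)
    (hZ : Measurable Z) (ξ : EuclideanSpace ℝ (Fin d)) {ε : ℝ} (hε : 0 ≤ ε) :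
    ‖charFun (P.map Y) ξ - charFun (P.map Z) ξ‖ ≤ ‖ξ‖ * ε + 2 * P.real {ω | ε ≤ ‖Y ω - Z ω‖} := by
  rw [charFun_apply, charFun_apply, integral_map hY.aemeasurable (by fun_prop),
    integral_map hZ.aemeasurable (by fun_prop)]
  have hi : ∀ W : Ω → EuclideanSpace ℝ (Fin d), Measurable W →
      Integrable (fun ω => Complex.exp ((inner ℝ (W ω) ξ : ℝ) * Complex.I)) P := fun W hW =>
    Integrable.of_bound (C := 1) (by fun_prop)
      (ae_of_all _ fun x => by rw [Complex.norm_exp_ofReal_mul_I])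
  have hs : MeasurableSet {ω | ε ≤ ‖Y ω - Z ω‖} :=
    measurableSet_le measurable_const (by fun_prop)
  rw [← integral_sub (hi Y hY) (hi Z hZ)]
  have hint : ∫ ω, (‖ξ‖ * ε + {ω | ε ≤ ‖Y ω - Z ω‖}.indicator (fun _ => (2 : ℝ)) ω) ∂P =
      ‖ξ‖ * ε + 2 * P.real {ω | ε ≤ ‖Y ω - Z ω‖} := by
    rw [integral_add (integrable_const _) ((integrable_const _).indicator hs),
      integral_indicator_const _ hs]
    simp [mul_comm]
  rw [← hint]
  refine norm_integral_le_of_norm_le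
    ((integrable_const _).add ((integrable_const _).indicator hs)) (ae_of_all _ fun ω => ?_)
  by_cases hω : ω ∈ {ω | ε ≤ ‖Y ω - Z ω‖}
  · rw [Set.indicator_of_mem hω]
    refine (norm_sub_le _ _).trans ?_
    rw [Complex.norm_exp_ofReal_mul_I, Complex.norm_exp_ofReal_mul_I]
    nlinarith [mul_nonneg (norm_nonneg ξ) hε]
  · rw [Set.indicator_of_notMem hω, add_zero]
    simp only [Set.mem_ofPred_eq, not_le] at hω
    have h1 : Complex.exp ((inner ℝ (Y ω) ξ : ℝ) * Complex.I) -
        Complex.exp ((inner ℝ (Z ω) ξ : ℝ) * Complex.I) =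
        Complex.exp ((inner ℝ (Z ω) ξ : ℝ) * Complex.I) *
          (Complex.exp (Complex.I * ((inner ℝ (Y ω - Z ω) ξ : ℝ) : ℂ)) - 1) := by
      rw [mul_sub, ← Complex.exp_add, inner_sub_left]
      push_cast
      ring_nf
    rw [h1, norm_mul, Complex.norm_exp_ofReal_mul_I, one_mul]
    refine Real.norm_exp_I_mul_ofReal_sub_one_le.trans ?_
    rw [Real.norm_eq_abs, mul_comm]
    exact (abs_real_inner_le_norm _ _).trans (by gcongr)

theorem IsAdditive.eventually_norm_charFun_sub_lt (hX : IsAdditive X P) (t₀ : ℝ≥0) (R : ℝ)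
    {ε : ℝ} (hε : 0 < ε) : ∀ᶠ t in 𝓝 t₀, ∀ ξ : EuclideanSpace ℝ (Fin d), ‖ξ‖ ≤ R →
      ‖charFun (P.map (X t)) ξ - charFun (P.map (X t₀)) ξ‖ < ε := by
  let η := ε / (2 * (|R| + 1))
  have hη : 0 < η := by positivity
  have h1 : Tendsto (fun t => P.real {ω | η ≤ ‖X t ω - X t₀ ω‖}) (𝓝 t₀) (𝓝 0) := by
    have := (ENNReal.tendsto_toReal ENNReal.zero_ne_top).comp (hX.stochCont t₀ η hη)
    simpa [Measure.real, Function.comp_def] using this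
  filter_upwards [h1.eventually_lt_const (show (0 : ℝ) < ε / 4 by positivity)] with t ht ξ hξ
  refine (norm_charFun_map_sub_le (hX.measurable t) (hX.measurable t₀) ξ hη.le).trans_lt ?_
  have h2 : ‖ξ‖ * η ≤ ε / 2 := by
    have : ‖ξ‖ * η ≤ (|R| + 1) * η := by
      gcongr
      linarith [le_abs_self R]
    refine this.trans (le_of_eq ?_)
    simp only [η]
    field_simp
  linarith

/-- Continuity of the characteristic function at `ξ` alone would determine the symbol only modulo
`2πi`. Uniformity along the segment from `0` to `ξ`, together with the value `0` at the origin,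
fixes the branch. -/
theorem continuous_levySymbol_time (hh : IsTruncation h) (hX : IsAdditive X P)
    (hc : IsCharTriplets h X P γ A ν) (ξ : EuclideanSpace ℝ (Fin d)) :
    Continuous fun t => levySymbol h (γ t) (A t) (ν t) ξ := by
  rw [continuous_iff_continuousAt]
  intro t₀
  have hψ : ∀ t, Continuous fun r : ℝ => levySymbol h (γ t) (A t) (ν t) (r • ξ) := fun t =>
    (continuous_levySymbol hh (hc.levy t) (γ t) (A t)).comp (by fun_prop)
  -- The least modulus of the characteristic function at time `t₀` on the segment: a perturbation
  -- smaller than this keeps the quotient within distance `1` of `1`.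
  obtain ⟨r₀, -, hr₀⟩ := (isCompact_Icc (a := (0 : ℝ)) (b := 1)).exists_isMinOn
    (Set.nonempty_Icc.2 zero_le_one)
    (f := fun r => ‖Complex.exp (levySymbol h (γ t₀) (A t₀) (ν t₀) (r • ξ))‖)
    (Complex.continuous_exp.comp (hψ t₀)).norm.continuousOn
  have hm : 0 < ‖Complex.exp (levySymbol h (γ t₀) (A t₀) (ν t₀) (r₀ • ξ))‖ :=
    norm_pos_iff.2 (Complex.exp_ne_zero _)
  have hlog : ∀ᶠ t in 𝓝 t₀, levySymbol h (γ t₀) (A t₀) (ν t₀) ξ +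
      Complex.log (charFun (P.map (X t)) ξ / charFun (P.map (X t₀)) ξ) =
        levySymbol h (γ t) (A t) (ν t) ξ := by
    filter_upwards [hX.eventually_norm_charFun_sub_lt t₀ ‖ξ‖ hm] with t ht
    have := eq_log_exp_of_continuousOn (f := fun r => levySymbol h (γ t) (A t) (ν t) (r • ξ) -
      levySymbol h (γ t₀) (A t₀) (ν t₀) (r • ξ)) ((hψ t).sub (hψ t₀)).continuousOn (by simp) ?_
    · rw [hc.charFun_eq, hc.charFun_eq, ← Complex.exp_sub]
      simp only [one_smul] at this
      rw [← this]
      ring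
    · intro r hr
      have hr1 : ‖r • ξ‖ ≤ ‖ξ‖ := by
        rw [norm_smul, Real.norm_of_nonneg hr.1]
        exact mul_le_of_le_one_left (norm_nonneg _) hr.2
      have h1 := (ht (r • ξ) hr1).trans_le (hr₀ hr)
      simp only [hc.charFun_eq] at h1
      have hne := Complex.exp_ne_zero (levySymbol h (γ t₀) (A t₀) (ν t₀) (r • ξ))
      rw [Complex.exp_sub, div_sub_one hne, norm_div, div_lt_one (norm_pos_iff.2 hne)]
      exact h1
  refine ContinuousAt.congr ?_ hlog
  have hφ : ContinuousAt (fun t => charFun (P.map (X t)) ξ) t₀ := by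
    rw [ContinuousAt, Metric.tendsto_nhds]
    intro ε hε
    filter_upwards [hX.eventually_norm_charFun_sub_lt t₀ ‖ξ‖ hε] with t ht
    rw [dist_eq_norm]
    exact ht ξ le_rfl
  have hne : charFun (P.map (X t₀)) ξ ≠ 0 := by
    rw [hc.charFun_eq]; exact Complex.exp_ne_zero _
  refine continuousAt_const.add (ContinuousAt.clog (hφ.div_const _) ?_)
  rw [div_self hne]
  exact Complex.one_mem_slitPlane

theorem charFun_increment (hX : IsAdditive X P) (hc : IsCharTriplets h X P γ A ν) {s t : ℝ≥0}
    (hst : s ≤ t) (ξ : EuclideanSpace ℝ (Fin d)) :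
    charFun (P.map (X t - X s)) ξ =
      Complex.exp (levySymbol h (γ t) (A t) (ν t) ξ - levySymbol h (γ s) (A s) (ν s) ξ) := by
  have hind := hX.indepIncrements.indepFun_eval_sub zero_le hst hX.zero
  have h1 := hind.charFun_map_add_eq_mul (hX.measurable s).aemeasurable
    ((hX.measurable t).sub (hX.measurable s)).aemeasurable
  rw [add_sub_cancel] at h1
  have h2 := congrFun h1 ξ
  simp only [Pi.mul_apply, hc.charFun_eq] at h2
  rw [Complex.exp_sub, h2]
  field_simp [Complex.exp_ne_zero]

end Paths

/-! ### The positive measure attached to an increment -/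

section Pair

variable {d : ℕ}

/-- The law of `Y + Y'` weighted by `1 - cos ⟪u, Y - Y'⟫`, for `Y, Y'` independent with law `μ`. -/
noncomputable def pairMeasure (μ : Measure (EuclideanSpace ℝ (Fin d)))
    (u : EuclideanSpace ℝ (Fin d)) : Measure (EuclideanSpace ℝ (Fin d)) :=
  ((μ.prod μ).withDensity fun p => ENNReal.ofReal (1 - Real.cos (inner ℝ u (p.1 - p.2)))).map
    fun p => p.1 + p.2

variable (μ : Measure (EuclideanSpace ℝ (Fin d))) [IsProbabilityMeasure μ]
  (u ξ : EuclideanSpace ℝ (Fin d))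

instance isFiniteMeasure_pairMeasure : IsFiniteMeasure (pairMeasure μ u) := by
  have : IsFiniteMeasure ((μ.prod μ).withDensity
      fun p => ENNReal.ofReal (1 - Real.cos (inner ℝ u (p.1 - p.2)))) := by
    refine isFiniteMeasure_withDensity_ofReal (Integrable.of_bound (C := 2) (by fun_prop)
      (ae_of_all _ fun p => ?_)).2
    rw [Real.norm_eq_abs, abs_le]
    constructor <;> linarith [Real.cos_le_one (inner ℝ u (p.1 - p.2)),
      Real.neg_one_le_cos (inner ℝ u (p.1 - p.2))]
  unfold pairMeasure
  infer_instance

/-- Write the cosine as exponentials: by independence, `e^{iξ·(Y+Y')} e^{±iu·(Y-Y')}` has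
expectation `φ(ξ+u) φ(ξ-u)` for either sign. -/
theorem charFun_pairMeasure : charFun (pairMeasure μ u) ξ =
    charFun μ ξ ^ 2 - charFun μ (ξ + u) * charFun μ (ξ - u) := by
  unfold pairMeasure
  rw [charFun_apply, integral_map (by fun_prop) (by fun_prop),
    integral_withDensity_eq_integral_toReal_smul (by fun_prop)
      (ae_of_all _ fun x => ENNReal.ofReal_lt_top)]
  let e : EuclideanSpace ℝ (Fin d) → EuclideanSpace ℝ (Fin d) → ℂ :=
    fun η x => Complex.exp ((inner ℝ x η : ℝ) * Complex.I)
  have hi : ∀ η ζ, Integrable (fun p : EuclideanSpace ℝ (Fin d) × EuclideanSpace ℝ (Fin d) =>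
      e η p.1 * e ζ p.2) (μ.prod μ) := by
    intro η ζ
    refine Integrable.of_bound (C := 1) (by fun_prop) (ae_of_all _ fun p => ?_)
    simp only [e]
    rw [norm_mul, Complex.norm_exp_ofReal_mul_I, Complex.norm_exp_ofReal_mul_I, one_mul]
  have hprod : ∀ η ζ, ∫ p, e η p.1 * e ζ p.2 ∂(μ.prod μ) = charFun μ η * charFun μ ζ :=
    fun η ζ => integral_prod_mul (μ := μ) (ν := μ) (e η) (e ζ)
  have hfun : ∀ p : EuclideanSpace ℝ (Fin d) × EuclideanSpace ℝ (Fin d),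
      (ENNReal.ofReal (1 - Real.cos (inner ℝ u (p.1 - p.2)))).toReal •
        Complex.exp ((inner ℝ (p.1 + p.2) ξ : ℝ) * Complex.I) =
      e ξ p.1 * e ξ p.2 - ((1 / 2 : ℂ) * (e (ξ + u) p.1 * e (ξ - u) p.2) +
        (1 / 2 : ℂ) * (e (ξ - u) p.1 * e (ξ + u) p.2)) := by
    intro p
    rw [ENNReal.toReal_ofReal (by linarith [Real.cos_le_one (inner ℝ u (p.1 - p.2))])]
    simp only [e, inner_add_left, inner_add_right, inner_sub_right, Complex.real_smul,
      Complex.ofReal_sub, Complex.ofReal_one, Complex.ofReal_cos, Complex.cos, add_mul, sub_mul,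
      Complex.exp_add, Complex.exp_sub, Complex.ofReal_add, neg_mul, Complex.exp_neg,
      real_inner_comm u]
    have h1 := Complex.exp_ne_zero (((inner ℝ u p.1 : ℝ) : ℂ) * Complex.I)
    have h2 := Complex.exp_ne_zero (((inner ℝ u p.2 : ℝ) : ℂ) * Complex.I)
    field_simp
  have hi2 : Integrable (fun p : EuclideanSpace ℝ (Fin d) × EuclideanSpace ℝ (Fin d) =>
      (1 / 2 : ℂ) * (e (ξ + u) p.1 * e (ξ - u) p.2) +
        (1 / 2 : ℂ) * (e (ξ - u) p.1 * e (ξ + u) p.2)) (μ.prod μ) :=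
    ((hi _ _).const_mul _).add ((hi _ _).const_mul _)
  simp_rw [hfun]
  rw [integral_sub (hi _ _) hi2,
    integral_add ((hi _ _).const_mul _) ((hi _ _).const_mul _), integral_const_mul,
    integral_const_mul, hprod, hprod, hprod]
  ring

/-- The right side is the total mass, that is, the value at `ξ = 0`. -/
theorem norm_charFun_pairMeasure_le :
    ‖charFun (pairMeasure μ u) ξ‖ ≤ 1 - ‖charFun μ u‖ ^ 2 := by
  refine (norm_charFun_le ξ).trans (le_of_eq ?_)
  have h1 := charFun_pairMeasure μ u 0
  rw [charFun_zero, charFun_zero, zero_add, zero_sub, charFun_neg, Complex.mul_conj] at h1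
  rw [← Complex.normSq_eq_norm_sq]
  apply Complex.ofReal_injective
  rw [h1]
  simp

end Pair

/-- To first order `e^y (e^z - 1)` is `z`. The error is measured against `e^y (e^z - 1)` itself,
since in the application this is bounded by the mass of a pair measure, which can be summed over a
partition. -/
theorem exists_norm_sub_exp_mul_le {ε : ℝ} (hε : 0 < ε) : ∃ δ > 0, ∀ z y : ℂ, ‖z‖ ≤ δ → ‖y‖ ≤ δ →
    ‖z - Complex.exp y * (Complex.exp z - 1)‖ ≤ ε * ‖Complex.exp y * (Complex.exp z - 1)‖ := by
  -- The bound `1 / 4` yields `‖z‖ ≤ 2‖e^z - 1‖` and `‖e^y‖ ≥ 1/2`. The bound `ε / 8` makes each of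
  -- the two error terms at most `(ε / 4)‖e^z - 1‖`.
  refine ⟨min (1 / 4) (ε / 8), by positivity, fun z y hz hy => ?_⟩
  have hz4 := hz.trans (min_le_left _ _)
  have hy4 := hy.trans (min_le_left _ _)
  have hzε := hz.trans (min_le_right _ _)
  have hyε := hy.trans (min_le_right _ _)
  have h1 := Complex.norm_exp_sub_one_sub_id_le (x := z) (by linarith)
  have h2 := Complex.norm_exp_sub_one_sub_id_le (x := y) (by linarith)
  have h3 : ‖z‖ ≤ 2 * ‖Complex.exp z - 1‖ := by
    have := norm_sub_norm_le z (z - (Complex.exp z - 1))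
    rw [sub_sub_cancel, norm_sub_rev z] at this
    nlinarith [norm_nonneg z]
  have h4 : ‖Complex.exp y - 1‖ ≤ 2 * ‖y‖ := by
    have := norm_add_le (Complex.exp y - 1 - y) y
    rw [sub_add_cancel] at this
    nlinarith [norm_nonneg y]
  have h5 : (1 / 2 : ℝ) ≤ ‖Complex.exp y‖ := by
    have := norm_sub_norm_le (1 : ℂ) (1 - Complex.exp y)
    rw [sub_sub_cancel, norm_sub_rev, norm_one] at this
    linarith
  have h6 : ‖z - Complex.exp y * (Complex.exp z - 1)‖ ≤
      ‖z‖ ^ 2 + 2 * ‖y‖ * ‖Complex.exp z - 1‖ := by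
    have : z - Complex.exp y * (Complex.exp z - 1) =
        -(Complex.exp z - 1 - z) - (Complex.exp y - 1) * (Complex.exp z - 1) := by ring
    rw [this]
    refine (norm_sub_le _ _).trans ?_
    rw [norm_neg, norm_mul]
    gcongr
  rw [norm_mul]
  have h7 := norm_nonneg (Complex.exp z - 1)
  calc _ ≤ ‖z‖ ^ 2 + 2 * ‖y‖ * ‖Complex.exp z - 1‖ := h6
    _ ≤ ε / 8 * (2 * ‖Complex.exp z - 1‖) + 2 * (ε / 8) * ‖Complex.exp z - 1‖ := by
        rw [pow_two]; gcongr
    _ = ε * ((1 / 2) * ‖Complex.exp z - 1‖) := by ring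
    _ ≤ _ := by gcongr

/-! ### Equidistant partitions -/

/-- The `k`-th point of the partition of `[s, t]` into `n + 1` intervals of equal length. -/
noncomputable def partitionPoint (s t : ℝ≥0) (n k : ℕ) : ℝ≥0 := s + k / (n + 1) * (t - s)

theorem partitionPoint_zero (s t : ℝ≥0) (n : ℕ) : partitionPoint s t n 0 = s := by
  simp [partitionPoint]

theorem partitionPoint_last {s t : ℝ≥0} (hst : s ≤ t) (n : ℕ) :
    partitionPoint s t n (n + 1) = t := by
  simp [partitionPoint, add_tsub_cancel_of_le hst]

theorem partitionPoint_monotone (s t : ℝ≥0) (n : ℕ) : Monotone (partitionPoint s t n) := by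
  intro j k hjk
  unfold partitionPoint
  gcongr

theorem partitionPoint_mem {s t : ℝ≥0} (hst : s ≤ t) {n k : ℕ} (hk : k ≤ n + 1) :
    partitionPoint s t n k ∈ Set.Icc s t :=
  ⟨(partitionPoint_zero s t n).symm.le.trans (partitionPoint_monotone s t n (zero_le)),
    (partitionPoint_monotone s t n hk).trans (partitionPoint_last hst n).le⟩

theorem dist_partitionPoint (s t : ℝ≥0) (n k : ℕ) :
    dist (partitionPoint s t n (k + 1)) (partitionPoint s t n k) = (t - s : ℝ≥0) / ((n : ℝ) + 1) := by
  have : ((n : ℝ) + 1) ≠ 0 := by positivity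
  rw [NNReal.dist_eq]
  have : ((partitionPoint s t n (k + 1) : ℝ≥0) : ℝ) - partitionPoint s t n k =
      (t - s : ℝ≥0) / ((n : ℝ) + 1) := by
    unfold partitionPoint
    push_cast
    field_simp
    ring
  rw [this, abs_of_nonneg (by positivity)]

theorem sum_partitionPoint_sub {F : Type*} [AddCommGroup F] (f : ℝ≥0 → F) {s t : ℝ≥0}
    (hst : s ≤ t) (n : ℕ) :
    ∑ k ∈ Finset.range (n + 1), (f (partitionPoint s t n (k + 1)) - f (partitionPoint s t n k)) =
      f t - f s := by
  rw [Finset.sum_range_sub (fun k => f (partitionPoint s t n k)), partitionPoint_zero,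
    partitionPoint_last hst]

theorem eventually_dist_partitionPoint_lt {F : Type*} [PseudoMetricSpace F] {f : ℝ≥0 → F}
    (hf : Continuous f) {s t : ℝ≥0} (hst : s ≤ t) {ε : ℝ} (hε : 0 < ε) :
    ∀ᶠ n in atTop, ∀ k ∈ Finset.range (n + 1),
      dist (f (partitionPoint s t n (k + 1))) (f (partitionPoint s t n k)) < ε := by
  have huc := (isCompact_Icc (a := s) (b := t)).uniformContinuousOn_of_continuous hf.continuousOn
  obtain ⟨δ, hδ, hfδ⟩ := Metric.uniformContinuousOn_iff.1 huc ε hε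
  have hlim : Tendsto (fun n : ℕ => ((t - s : ℝ≥0) : ℝ) / ((n : ℝ) + 1)) atTop (𝓝 0) :=
    tendsto_const_nhds.div_atTop (tendsto_natCast_atTop_atTop.atTop_add tendsto_const_nhds)
  filter_upwards [hlim.eventually_lt_const hδ] with n hn k hk
  have hk := Finset.mem_range.1 hk
  refine hfδ _ (partitionPoint_mem hst (by omega)) _ (partitionPoint_mem hst (by omega)) ?_
  rwa [dist_partitionPoint]

theorem charFun_finsetSum {d : ℕ} {ι : Type*} (I : Finset ι)
    (μ : ι → Measure (EuclideanSpace ℝ (Fin d))) [∀ i, IsFiniteMeasure (μ i)]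
    (ξ : EuclideanSpace ℝ (Fin d)) :
    charFun (∑ i ∈ I, μ i) ξ = ∑ i ∈ I, charFun (μ i) ξ := by
  simp only [charFun_apply]
  refine integral_finsetSum_measure fun i _ => ?_
  exact Integrable.of_bound (C := 1) (by fun_prop)
    (ae_of_all _ fun x => by rw [Complex.norm_exp_ofReal_mul_I])

/-! ### Monotonicity of the second-difference measures -/

section Monotone

variable {d : ℕ} {Ω : Type*} [MeasurableSpace Ω] {P : Measure Ω} [IsProbabilityMeasure P]
  {X : ℝ≥0 → Ω → EuclideanSpace ℝ (Fin d)}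
  {h : EuclideanSpace ℝ (Fin d) → EuclideanSpace ℝ (Fin d)}
  {γ : ℝ≥0 → EuclideanSpace ℝ (Fin d)} {A : ℝ≥0 → Matrix (Fin d) (Fin d) ℝ}
  {ν : ℝ≥0 → Measure (EuclideanSpace ℝ (Fin d))}

/-- The characteristic functions of the weighted increments of a partition approximate the
increment of the second difference of the Lévy symbol. -/
theorem tendsto_sum_charFun_pairMeasure (hh : IsTruncation h) (hX : IsAdditive X P)
    (hc : IsCharTriplets h X P γ A ν) {s t : ℝ≥0} (hst : s ≤ t)
    (u ξ : EuclideanSpace ℝ (Fin d)) :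
    Tendsto (fun n => ∑ k ∈ Finset.range (n + 1), charFun (pairMeasure
      (P.map (X (partitionPoint s t n (k + 1)) - X (partitionPoint s t n k))) u) ξ) atTop
      (𝓝 (charFun (diffMeasure (A t) (ν t) u) ξ - charFun (diffMeasure (A s) (ν s) u) ξ)) := by
  let ψ : ℝ≥0 → EuclideanSpace ℝ (Fin d) → ℂ := fun t => levySymbol h (γ t) (A t) (ν t)
  have hψ : ∀ η, Continuous fun t => ψ t η := continuous_levySymbol_time hh hX hc
  let Z : ℝ≥0 → ℂ := fun t => 2 * ψ t ξ - ψ t (ξ + u) - ψ t (ξ - u)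
  let Y : ℝ≥0 → ℂ := fun t => ψ t (ξ + u) + ψ t (ξ - u)
  have hZ : Continuous Z := ((continuous_const.mul (hψ _)).sub (hψ _)).sub (hψ _)
  have hY : Continuous Y := (hψ _).add (hψ _)
  have hZd : ∀ t, charFun (diffMeasure (A t) (ν t) u) ξ = Z t := fun t =>
    charFun_diffMeasure hh (hc.levy t) (γ t) (hc.posSemidef t) u ξ
  rw [hZd, hZd, Metric.tendsto_nhds]
  intro ε hε
  -- Over an increment the pair measure has mass `1 - e^{-a}`, with `a` the increment of `V`. As `1
  -- - e^{-a} ≤ a`, the masses sum to at most `V t - V s`.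
  let V : ℝ≥0 → ℝ := fun t => -2 * (ψ t u).re
  obtain ⟨δ, hδ, hest⟩ := exists_norm_sub_exp_mul_le
    (show 0 < ε / (|V t - V s| + 1) by positivity)
  filter_upwards [eventually_dist_partitionPoint_lt hZ hst hδ,
    eventually_dist_partitionPoint_lt hY hst hδ] with n hnZ hnY
  set τ := partitionPoint s t n with hτ
  have hτm : ∀ k, τ k ≤ τ (k + 1) := fun k => partitionPoint_monotone s t n (Nat.le_succ k)
  have hterm : ∀ k ∈ Finset.range (n + 1),
      ‖charFun (pairMeasure (P.map (X (τ (k + 1)) - X (τ k))) u) ξ - (Z (τ (k + 1)) - Z (τ k))‖ ≤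
        ε / (|V t - V s| + 1) * (V (τ (k + 1)) - V (τ k)) := by
    intro k hk
    have hprob : IsProbabilityMeasure (P.map (X (τ (k + 1)) - X (τ k))) :=
      Measure.isProbabilityMeasure_map
        ((hX.measurable _).sub (hX.measurable _)).aemeasurable
    -- For the increment, `φ(ξ+u) φ(ξ-u)` is the exponential of the increment of `Y`, and `φ(ξ)²`
    -- that of `Y + Z`.
    have hp : charFun (pairMeasure (P.map (X (τ (k + 1)) - X (τ k))) u) ξ =
        Complex.exp (Y (τ (k + 1)) - Y (τ k)) *
          (Complex.exp (Z (τ (k + 1)) - Z (τ k)) - 1) := by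
      rw [charFun_pairMeasure, charFun_increment hX hc (hτm k), charFun_increment hX hc (hτm k),
        charFun_increment hX hc (hτm k), ← Complex.exp_nat_mul, ← Complex.exp_add,
        show ∀ y z, Complex.exp y * (Complex.exp z - 1) = Complex.exp (y + z) - Complex.exp y from
          fun y z => by rw [Complex.exp_add]; ring]
      simp only [Y, Z, ψ]
      congr 2 <;> push_cast <;> ring
    have hle := norm_charFun_pairMeasure_le (P.map (X (τ (k + 1)) - X (τ k))) u ξ
    have hV : 1 - ‖charFun (P.map (X (τ (k + 1)) - X (τ k))) u‖ ^ 2 ≤ V (τ (k + 1)) - V (τ k) := by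
      rw [charFun_increment hX hc (hτm k), Complex.norm_exp, ← Real.exp_nat_mul]
      have := Real.add_one_le_exp (((2 : ℕ) : ℝ) * (levySymbol h (γ (τ (k + 1))) (A (τ (k + 1)))
        (ν (τ (k + 1))) u - levySymbol h (γ (τ k)) (A (τ k)) (ν (τ k)) u).re)
      simp only [V, ψ]
      rw [Complex.sub_re] at this ⊢
      push_cast at this ⊢
      linarith
    have h1 := hest (Z (τ (k + 1)) - Z (τ k)) (Y (τ (k + 1)) - Y (τ k))
      (by simpa [dist_eq_norm] using (hnZ k hk).le) (by simpa [dist_eq_norm] using (hnY k hk).le)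
    rw [← hp] at h1
    rw [norm_sub_rev]
    refine h1.trans ?_
    gcongr
    exact hle.trans hV
  rw [dist_eq_norm, ← sum_partitionPoint_sub Z hst n, ← Finset.sum_sub_distrib]
  refine (norm_sum_le_of_le _ hterm).trans_lt ?_
  rw [← Finset.mul_sum, sum_partitionPoint_sub V hst n]
  have h2 := le_abs_self (V t - V s)
  rw [div_mul_eq_mul_div, div_lt_iff₀ (by positivity)]
  nlinarith

/-- The difference of the two characteristic functions is a limit of characteristic functions of
positive measures, namely the pair measures summed over partitions. -/
theorem diffMeasure_mono (hh : IsTruncation h) (hX : IsAdditive X P)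
    (hc : IsCharTriplets h X P γ A ν) {s t : ℝ≥0} (hst : s ≤ t) (u : EuclideanSpace ℝ (Fin d)) :
    diffMeasure (A s) (ν s) u ≤ diffMeasure (A t) (ν t) u := by
  have := isFiniteMeasure_diffMeasure (hc.levy s) (A s) u
  have := isFiniteMeasure_diffMeasure (hc.levy t) (A t) u
  have hprob : ∀ n k, IsProbabilityMeasure
      (P.map (X (partitionPoint s t n (k + 1)) - X (partitionPoint s t n k))) := fun n k =>
    Measure.isProbabilityMeasure_map ((hX.measurable _).sub (hX.measurable _)).aemeasurable
  refine le_of_tendsto_charFun (M := fun n => ∑ k ∈ Finset.range (n + 1), pairMeasure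
    (P.map (X (partitionPoint s t n (k + 1)) - X (partitionPoint s t n k))) u) fun ξ => ?_
  simp only [charFun_finsetSum]
  exact tendsto_sum_charFun_pairMeasure hh hX hc hst u ξ

end Monotone

/-! ### Recovering the Gaussian part and the Lévy measure -/

section Extract

variable {d : ℕ} {ν ν' : Measure (EuclideanSpace ℝ (Fin d))} {A A' : Matrix (Fin d) (Fin d) ℝ}

/-- The density `2(1 - cos(u·x))` vanishes at `0`, so the atom there has mass exactly `u · A u`. -/
theorem quadForm_le_of_diffMeasure_le (hA' : A'.PosSemidef)
    {u : EuclideanSpace ℝ (Fin d)} (hle : diffMeasure A ν u ≤ diffMeasure A' ν' u) :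
    u.ofLp ⬝ᵥ (A *ᵥ u.ofLp) ≤ u.ofLp ⬝ᵥ (A' *ᵥ u.ofLp) := by
  have h0 : ∀ (B : Matrix (Fin d) (Fin d) ℝ) (μ : Measure (EuclideanSpace ℝ (Fin d))),
      diffMeasure B μ u {0} = ENNReal.ofReal (u.ofLp ⬝ᵥ (B *ᵥ u.ofLp)) := by
    intro B μ
    simp [diffMeasure]
  have := hle {0}
  rw [h0, h0] at this
  exact (ENNReal.ofReal_le_ofReal_iff (by simpa using hA'.dotProduct_mulVec_nonneg u.ofLp)).1 this

/-- The density can be divided out wherever it is positive, and countably many `u` suffice to make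
it positive somewhere at each `x ≠ 0`. -/
theorem le_of_diffMeasure_le (hν : ν {0} = 0)
    (hle : ∀ u, diffMeasure A ν u ≤ diffMeasure A' ν' u) : ν ≤ ν' := by
  let f : EuclideanSpace ℝ (Fin d) → EuclideanSpace ℝ (Fin d) → ℝ≥0∞ :=
    fun u x => ENNReal.ofReal (2 * (1 - Real.cos (inner ℝ u x)))
  have hfm : ∀ u, Measurable (f u) := fun u => by fun_prop
  have hdiff : ∀ (B : Matrix (Fin d) (Fin d) ℝ) (μ : Measure (EuclideanSpace ℝ (Fin d))) u s,
      MeasurableSet s → (0 : EuclideanSpace ℝ (Fin d)) ∉ s →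
      diffMeasure B μ u s = ∫⁻ x in s, f u x ∂μ := by
    intro B μ u s hs h0
    simp [diffMeasure, withDensity_apply _ hs, h0, hs, f]
  -- On the set where the density is positive, the measures are ordered.
  have hpos : ∀ u s, MeasurableSet s → (∀ x ∈ s, f u x ≠ 0) → ν s ≤ ν' s := by
    intro u s hs hsu
    have h0 : ∀ r ⊆ s, (0 : EuclideanSpace ℝ (Fin d)) ∉ r := fun r hr h0 =>
      hsu 0 (hr h0) (by simp [f])
    have hrestr : (ν.restrict s).withDensity (f u) ≤ (ν'.restrict s).withDensity (f u) := by
      rw [Measure.le_iff]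
      intro r hr
      rw [withDensity_apply _ hr, withDensity_apply _ hr, Measure.restrict_restrict hr,
        Measure.restrict_restrict hr, ← hdiff A ν u _ (hr.inter hs) (h0 _ Set.inter_subset_right),
        ← hdiff A' ν' u _ (hr.inter hs) (h0 _ Set.inter_subset_right)]
      exact hle u _
    have hinv : ∀ μ : Measure (EuclideanSpace ℝ (Fin d)),
        ∫⁻ x, (f u x)⁻¹ ∂((μ.restrict s).withDensity (f u)) = μ s := by
      intro μ
      rw [lintegral_withDensity_eq_lintegral_mul (μ.restrict s) (hfm u) (g := fun x => (f u x)⁻¹)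
        (hfm u).inv, ← setLIntegral_one]
      refine setLIntegral_congr_fun hs fun x hx => ?_
      simp only [Pi.mul_apply]
      exact ENNReal.mul_inv_cancel (hsu x hx) ENNReal.ofReal_ne_top
    rw [← hinv ν, ← hinv ν']
    exact lintegral_mono' hrestr le_rfl
  let v := TopologicalSpace.denseSeq (EuclideanSpace ℝ (Fin d))
  let S : ℕ → Set (EuclideanSpace ℝ (Fin d)) := fun n => {x | f (v n) x ≠ 0}
  have hS : ∀ n, MeasurableSet (S n) := fun n => (hfm _ (measurableSet_singleton 0)).compl
  have hcov : {0}ᶜ ⊆ ⋃ n, S n := by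
    intro x hx
    have hx0 : 0 < ‖x‖ ^ 2 := pow_pos (norm_pos_iff.2 hx) 2
    have hopen : IsOpen {u : EuclideanSpace ℝ (Fin d) | Real.cos (inner ℝ u x) ≠ 1} :=
      isOpen_ne_fun (by fun_prop) continuous_const
    obtain ⟨n, hu⟩ := (TopologicalSpace.denseRange_denseSeq
      (EuclideanSpace ℝ (Fin d))).exists_mem_open hopen
      -- This `u` satisfies `u·x = π`, so the cosine is `-1`; density then supplies a term of the
      -- sequence.
      ⟨(Real.pi / ‖x‖ ^ 2) • x, by
        simp only [Set.mem_ofPred_eq]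
        rw [real_inner_smul_left, real_inner_self_eq_norm_sq, div_mul_cancel₀ _ hx0.ne',
          Real.cos_pi]
        norm_num⟩
    refine Set.mem_iUnion.2 ⟨n, ?_⟩
    have : Real.cos (inner ℝ (v n) x) < 1 := lt_of_le_of_ne (Real.cos_le_one _) hu
    simp only [S, f, Set.mem_ofPred_eq, ne_eq, ENNReal.ofReal_eq_zero, not_le]
    linarith
  rw [Measure.le_iff]
  intro s hs
  calc ν s = ν (s ∩ {0}ᶜ) := by
        refine (measure_inter_conull ?_).symm
        simpa using hν
    -- The comparison holds only inside a single `S n`, hence the disjoint pieces.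
    _ ≤ ν (⋃ n, s ∩ disjointed S n) := by
        rw [← Set.inter_iUnion, iUnion_disjointed]
        gcongr
    _ = ∑' n, ν (s ∩ disjointed S n) := by
        refine measure_iUnion (fun i j hij => ?_) fun n => hs.inter (.disjointed hS n)
        exact ((disjoint_disjointed S hij).mono Set.inter_subset_right Set.inter_subset_right)
    _ ≤ ∑' n, ν' (s ∩ disjointed S n) := by
        refine ENNReal.tsum_le_tsum fun n => hpos (v n) _ (hs.inter (.disjointed hS n)) ?_
        exact fun x hx => disjointed_subset S n hx.2
    _ = ν' (⋃ n, s ∩ disjointed S n) := by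
        refine (measure_iUnion (fun i j hij => ?_) fun n => hs.inter (.disjointed hS n)).symm
        exact ((disjoint_disjointed S hij).mono Set.inter_subset_right Set.inter_subset_right)
    _ ≤ ν' s := measure_mono (Set.iUnion_subset fun n => Set.inter_subset_left)

end Extract

/-- The increments of `f` are bounded by those of `g`. -/
theorem continuous_of_monotone_of_monotone_sub {f g : ℝ≥0 → ℝ} (hf : Monotone f)
    (hgf : Monotone fun t => g t - f t) (hg : Continuous g) : Continuous f := by
  have hle : ∀ s t, dist (f s) (f t) ≤ dist (g s) (g t) := by
    have key : ∀ s t, s ≤ t → dist (f s) (f t) ≤ dist (g s) (g t) := by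
      intro s t hst
      have h1 := hf hst
      have h2 := hgf hst
      simp only at h2
      rw [dist_comm, dist_comm (g s), Real.dist_eq, Real.dist_eq, abs_of_nonneg (by linarith),
        abs_of_nonneg (by linarith)]
      linarith
    intro s t
    rcases le_total s t with hst | hst
    · exact key s t hst
    · rw [dist_comm, dist_comm (g s)]
      exact key t s hst
  rw [continuous_iff_continuousAt]
  intro t
  have ht := hg.continuousAt (x := t)
  rw [ContinuousAt, tendsto_iff_dist_tendsto_zero] at ht ⊢
  exact squeeze_zero (fun _ => dist_nonneg) (fun s => hle s t) ht

/-! ### Gaussian averaging against a Lévy measure -/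

section Levy

variable {d : ℕ} {ν ν' : Measure (EuclideanSpace ℝ (Fin d))}

theorem IsLevyMeasure.ae_ne_zero (hν : IsLevyMeasure ν) : ∀ᵐ x ∂ν, x ≠ 0 := by
  rw [ae_iff]
  simpa using hν.zero

/-- The measure with density `min(|x|², 1)` is finite, and this density is positive almost
everywhere and can be inverted. Needed for Fubini. -/
theorem IsLevyMeasure.sFinite (hν : IsLevyMeasure ν) : SFinite ν := by
  let m : EuclideanSpace ℝ (Fin d) → ℝ≥0∞ := fun x => ENNReal.ofReal (min (‖x‖ ^ 2) 1)
  have hm : Measurable m := by fun_prop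
  have h1 : (ν.withDensity m).withDensity m⁻¹ = ν := by
    refine withDensity_inv_same hm ?_ (ae_of_all _ fun x => ENNReal.ofReal_ne_top)
    filter_upwards [hν.ae_ne_zero] with x hx
    have : 0 < ‖x‖ := norm_pos_iff.2 hx
    simp only [m, ne_eq, ENNReal.ofReal_eq_zero, not_le]
    positivity
  have : IsFiniteMeasure (ν.withDensity m) :=
    isFiniteMeasure_withDensity (by exact hν.lintegral_lt_top.ne)
  rw [← h1]
  infer_instance

theorem IsLevyMeasure.integrable_of_norm_le_of_ne {F : Type*} [NormedAddCommGroup F]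
    [NormedSpace ℝ F] (hν : IsLevyMeasure ν) {g : EuclideanSpace ℝ (Fin d) → F}
    (hg : AEStronglyMeasurable g ν) (C : ℝ)
    (hC : ∀ x, x ≠ 0 → ‖g x‖ ≤ C * min (‖x‖ ^ 2) 1) : Integrable g ν :=
  (hν.integrable_min.const_mul C).mono' hg (hν.ae_ne_zero.mono fun x hx => hC x hx)

/-- With `one_sub_exp_le_min`, this makes `1 - e^{-|x|²/2}` comparable to `min(|x|², 1)`. -/
theorem min_le_three_mul_one_sub_exp {y : ℝ} (hy : 0 ≤ y) :
    min y 1 ≤ 3 * (1 - Real.exp (-y / 2)) := by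
  have h1 := Real.add_one_le_exp (y / 2)
  have h2 : Real.exp (-y / 2) * Real.exp (y / 2) = 1 := by
    rw [← Real.exp_add]
    simp [neg_div]
  have h3 := Real.exp_pos (-y / 2)
  have h4 : Real.exp (-y / 2) * (y / 2 + 1) ≤ 1 := by nlinarith
  have h5 : Real.exp (-y / 2) ≤ 1 / (y / 2 + 1) := by
    rwa [le_div_iff₀ (by positivity)]
  have h6 : 3 * (1 - 1 / (y / 2 + 1)) = 3 * y / (y + 2) := by
    field_simp
    ring
  have h7 : min y 1 ≤ 3 * y / (y + 2) := by
    rw [le_div_iff₀ (by positivity)]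
    rcases le_total y 1 with h | h
    · rw [min_eq_left h]; nlinarith
    · rw [min_eq_right h]; linarith
  linarith

theorem one_sub_exp_le_min (y : ℝ) (hy : 0 ≤ y) : 1 - Real.exp (-y / 2) ≤ min y 1 := by
  refine le_min ?_ (by linarith [Real.exp_pos (-y / 2)])
  linarith [Real.add_one_le_exp (-y / 2)]

theorem IsLevyMeasure.integrable_one_sub_exp (hν : IsLevyMeasure ν) :
    Integrable (fun x => 1 - Real.exp (-‖x‖ ^ 2 / 2)) ν := by
  refine hν.integrable_of_norm_le (by fun_prop) 1 fun x => ?_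
  have h1 : Real.exp (-‖x‖ ^ 2 / 2) ≤ 1 := Real.exp_le_one_iff.2 (by
    have := sq_nonneg ‖x‖
    linarith)
  rw [Real.norm_of_nonneg (by linarith), one_mul]
  exact one_sub_exp_le_min _ (sq_nonneg _)

theorem integrable_norm_sq_stdGaussian :
    Integrable (fun u => ‖u‖ ^ 2) (stdGaussian (EuclideanSpace ℝ (Fin d))) :=
  (IsGaussian.memLp_two_id (μ := stdGaussian (EuclideanSpace ℝ (Fin d)))).integrable_norm_pow
    (by norm_num)

theorem integral_cos_stdGaussian (x : EuclideanSpace ℝ (Fin d)) :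
    ∫ u, Real.cos (inner ℝ u x) ∂(stdGaussian (EuclideanSpace ℝ (Fin d))) =
      Real.exp (-‖x‖ ^ 2 / 2) := by
  have h1 := charFun_stdGaussian (E := EuclideanSpace ℝ (Fin d)) x
  rw [charFun_apply] at h1
  have hi : Integrable (fun u => Complex.exp ((inner ℝ u x : ℝ) * Complex.I))
      (stdGaussian (EuclideanSpace ℝ (Fin d))) :=
    Integrable.of_bound (C := 1) (by fun_prop)
      (ae_of_all _ fun u => by rw [Complex.norm_exp_ofReal_mul_I])
  have h2 := integral_re hi
  simp only [RCLike.re_to_complex, Complex.exp_ofReal_mul_I_re] at h2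
  rw [h2, h1, ← Complex.exp_ofReal_re]
  congr 2
  push_cast
  ring

/-- Fubini, since the mean of `cos(u·x)` over standard Gaussian `u` is `e^{-|x|²/2}`. -/
theorem integral_one_sub_exp_eq (hν : IsLevyMeasure ν) :
    ∫ x, (1 - Real.exp (-‖x‖ ^ 2 / 2)) ∂ν =
      ∫ u, ∫ x, (1 - Real.cos (inner ℝ u x)) ∂ν ∂(stdGaussian (EuclideanSpace ℝ (Fin d))) := by
  have := hν.sFinite
  rw [integral_integral_swap]
  · refine integral_congr_ae (ae_of_all _ fun x => ?_)
    simp only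
    rw [integral_sub (integrable_const _), integral_cos_stdGaussian]
    · simp
    · exact Integrable.of_bound (C := 1) (by fun_prop)
        (ae_of_all _ fun u => Real.abs_cos_le_one _)
  · refine ((integrable_norm_sq_stdGaussian.add (integrable_const 2)).mul_prod
      hν.integrable_min).mono' (by fun_prop) (ae_of_all _ fun p => ?_)
    simp only [Function.uncurry, Pi.add_apply]
    rw [Real.norm_of_nonneg (by linarith [Real.cos_le_one (inner ℝ p.1 p.2)])]
    exact one_sub_cos_le p.1 p.2

end Levy

/-! ### Monotonicity and continuity of the characteristics, and their values at time zero -/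

section Paths

variable {d : ℕ} {Ω : Type*} [MeasurableSpace Ω] {P : Measure Ω} [IsProbabilityMeasure P]
  {X : ℝ≥0 → Ω → EuclideanSpace ℝ (Fin d)}
  {h : EuclideanSpace ℝ (Fin d) → EuclideanSpace ℝ (Fin d)}
  {γ : ℝ≥0 → EuclideanSpace ℝ (Fin d)} {A : ℝ≥0 → Matrix (Fin d) (Fin d) ℝ}
  {ν : ℝ≥0 → Measure (EuclideanSpace ℝ (Fin d))}

theorem monotone_levyMeasure (hh : IsTruncation h) (hX : IsAdditive X P)
    (hc : IsCharTriplets h X P γ A ν) : Monotone ν := fun _ _ hst =>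
  le_of_diffMeasure_le (hc.levy _).zero fun u => diffMeasure_mono hh hX hc hst u

theorem monotone_quadForm (hh : IsTruncation h) (hX : IsAdditive X P)
    (hc : IsCharTriplets h X P γ A ν) (u : EuclideanSpace ℝ (Fin d)) :
    Monotone fun t => u.ofLp ⬝ᵥ (A t *ᵥ u.ofLp) := fun _ t hst =>
  quadForm_le_of_diffMeasure_le (hc.posSemidef t) (diffMeasure_mono hh hX hc hst u)

theorem monotone_integral (hh : IsTruncation h) (hX : IsAdditive X P)
    (hc : IsCharTriplets h X P γ A ν) {g : EuclideanSpace ℝ (Fin d) → ℝ}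
    (hg : ∀ t, Integrable g (ν t)) (hg0 : ∀ x, x ≠ 0 → 0 ≤ g x) :
    Monotone fun t => ∫ x, g x ∂(ν t) := fun _ t hst =>
  integral_mono_measure (monotone_levyMeasure hh hX hc hst)
    ((hc.levy t).ae_ne_zero.mono fun x hx => hg0 x hx) (hg t)

/-- This sum is the mass of `diffMeasure`, hence a combination of values of the symbol, which are
continuous in time. -/
theorem continuous_quadForm_add_integral (hh : IsTruncation h) (hX : IsAdditive X P)
    (hc : IsCharTriplets h X P γ A ν) (u : EuclideanSpace ℝ (Fin d)) :
    Continuous fun t => u.ofLp ⬝ᵥ (A t *ᵥ u.ofLp) +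
      ∫ x, 2 * (1 - Real.cos (inner ℝ u x)) ∂(ν t) := by
  have h1 : ∀ t, u.ofLp ⬝ᵥ (A t *ᵥ u.ofLp) + ∫ x, 2 * (1 - Real.cos (inner ℝ u x)) ∂(ν t) =
      (2 * levySymbol h (γ t) (A t) (ν t) 0 - levySymbol h (γ t) (A t) (ν t) (0 + u)
        - levySymbol h (γ t) (A t) (ν t) (0 - u)).re := by
    intro t
    have h2 := integral_diffMeasure (hc.levy t) (hc.posSemidef t) u
      (g := fun _ => (1 : ℝ)) continuous_const 1 (fun x => by simp)
    rw [← charFun_diffMeasure hh (hc.levy t) (γ t) (hc.posSemidef t), charFun_zero,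
      Complex.ofReal_re]
    simpa using h2.symm
  simp only [h1]
  have hψ := continuous_levySymbol_time hh hX hc
  exact Complex.continuous_re.comp (((continuous_const.mul (hψ 0)).sub (hψ _)).sub (hψ _))

theorem continuous_quadForm (hh : IsTruncation h) (hX : IsAdditive X P)
    (hc : IsCharTriplets h X P γ A ν) (u : EuclideanSpace ℝ (Fin d)) :
    Continuous fun t => u.ofLp ⬝ᵥ (A t *ᵥ u.ofLp) := by
  refine continuous_of_monotone_of_monotone_sub (monotone_quadForm hh hX hc u) ?_
    (continuous_quadForm_add_integral hh hX hc u)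
  simp only [add_sub_cancel_left]
  exact monotone_integral hh hX hc (fun t => ((hc.levy t).integrable_one_sub_cos u).const_mul 2)
    fun x _ => by linarith [Real.cos_le_one (inner ℝ u x)]

theorem continuous_integral_one_sub_cos (hh : IsTruncation h) (hX : IsAdditive X P)
    (hc : IsCharTriplets h X P γ A ν) (u : EuclideanSpace ℝ (Fin d)) :
    Continuous fun t => ∫ x, (1 - Real.cos (inner ℝ u x)) ∂(ν t) := by
  have h1 := (continuous_quadForm_add_integral hh hX hc u).sub (continuous_quadForm hh hX hc u)
  simp only [integral_const_mul] at h1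
  simpa using h1.const_mul (1 / 2 : ℝ)

theorem continuous_integral_one_sub_exp (hh : IsTruncation h) (hX : IsAdditive X P)
    (hc : IsCharTriplets h X P γ A ν) :
    Continuous fun t => ∫ x, (1 - Real.exp (-‖x‖ ^ 2 / 2)) ∂(ν t) := by
  have h1 := fun t => integral_one_sub_exp_eq (hc.levy t)
  simp only [h1]
  rw [continuous_iff_continuousAt]
  intro t₀
  have hsf := fun t => (hc.levy t).sFinite
  refine continuousAt_of_dominated
    -- For `t < t₀ + 1`, monotonicity of the Lévy measures allows `ν t` to be replaced by `ν (t₀ +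
    -- 1)`.
    (bound := fun u => (‖u‖ ^ 2 + 2) * ∫ x, min (‖x‖ ^ 2) 1 ∂(ν (t₀ + 1))) ?_ ?_
    ((integrable_norm_sq_stdGaussian.add (integrable_const 2)).mul_const _)
    (ae_of_all _ fun u => (continuous_integral_one_sub_cos hh hX hc u).continuousAt)
  · refine Eventually.of_forall fun t => ?_
    have : StronglyMeasurable (Function.uncurry fun u x : EuclideanSpace ℝ (Fin d) =>
        1 - Real.cos (inner ℝ u x)) := by
      refine Continuous.stronglyMeasurable ?_
      unfold Function.uncurry
      fun_prop
    exact this.integral_prod_right.aestronglyMeasurable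
  · have : ∀ᶠ t in 𝓝 t₀, t < t₀ + 1 := eventually_lt_nhds (by simp)
    filter_upwards [this] with t ht
    refine ae_of_all _ fun u => ?_
    have hnn : ∀ x, 0 ≤ 1 - Real.cos (inner ℝ u x) := fun x => by
      linarith [Real.cos_le_one (inner ℝ u x)]
    rw [Real.norm_of_nonneg (integral_nonneg hnn), ← integral_const_mul]
    refine (monotone_integral hh hX hc (fun t => (hc.levy t).integrable_one_sub_cos u)
      (fun x _ => hnn x) ht.le).trans ?_
    exact integral_mono ((hc.levy _).integrable_one_sub_cos u)
      ((hc.levy _).integrable_min.const_mul _) fun x => one_sub_cos_le u x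

/-- A multiple of `1 - e^{-|x|²/2}` dominates `g`, so by monotonicity of the Lévy measures its
integral has the larger increments, and that integral is continuous. -/
theorem continuous_integral (hh : IsTruncation h) (hX : IsAdditive X P)
    (hc : IsCharTriplets h X P γ A ν) {g : EuclideanSpace ℝ (Fin d) → ℝ} (hg : Measurable g)
    {C : ℝ} (hg0 : ∀ x, x ≠ 0 → 0 ≤ g x)
    (hC : ∀ x, x ≠ 0 → g x ≤ C * min (‖x‖ ^ 2) 1) :
    Continuous fun t => ∫ x, g x ∂(ν t) := by
  have hi : ∀ t, Integrable g (ν t) := fun t =>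
    (hc.levy t).integrable_of_norm_le_of_ne hg.aestronglyMeasurable C fun x hx => by
      rw [Real.norm_of_nonneg (hg0 x hx)]; exact hC x hx
  have hG := fun t => ((hc.levy t).integrable_one_sub_exp).const_mul (|C| * 3)
  refine continuous_of_monotone_of_monotone_sub (monotone_integral hh hX hc hi hg0)
    (g := fun t => ∫ x, |C| * 3 * (1 - Real.exp (-‖x‖ ^ 2 / 2)) ∂(ν t)) ?_ ?_
  · simp only [← integral_sub (hG _) (hi _)]
    refine monotone_integral hh hX hc (fun t => (hG t).sub (hi t)) fun x hx => ?_
    have h1 := min_le_three_mul_one_sub_exp (sq_nonneg ‖x‖)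
    have h2 : C * min (‖x‖ ^ 2) 1 ≤ |C| * (3 * (1 - Real.exp (-‖x‖ ^ 2 / 2))) := by
      have : 0 ≤ min (‖x‖ ^ 2) 1 := by positivity
      gcongr
      exact le_abs_self C
    linarith [hC x hx]
  · simp only [integral_const_mul]
    exact (continuous_integral_one_sub_exp hh hX hc).const_mul _

/-- The exponential of the symbol is identically `1`, and continuity along rays from the origin
excludes nonzero multiples of `2πi`. Time zero matters because convergence is assumed only for `t >
0`. -/
theorem levySymbol_time_zero (hh : IsTruncation h) (hX : IsAdditive X P)
    (hc : IsCharTriplets h X P γ A ν) (ξ : EuclideanSpace ℝ (Fin d)) :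
    levySymbol h (γ 0) (A 0) (ν 0) ξ = 0 := by
  have hexp : ∀ η, Complex.exp (levySymbol h (γ 0) (A 0) (ν 0) η) = 1 := by
    intro η
    rw [← hc.charFun_eq, Measure.map_congr (g := fun _ => 0) hX.zero]
    simp
  have hcont : Continuous fun r : ℝ => levySymbol h (γ 0) (A 0) (ν 0) (r • ξ) :=
    (continuous_levySymbol hh (hc.levy 0) (γ 0) (A 0)).comp (by fun_prop)
  have := eq_log_exp_of_continuousOn (f := fun r => levySymbol h (γ 0) (A 0) (ν 0) (r • ξ))
    hcont.continuousOn (by simp) (fun r _ => by simp [hexp])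
  simpa [hexp] using this

theorem diffMeasure_time_zero (hh : IsTruncation h) (hX : IsAdditive X P)
    (hc : IsCharTriplets h X P γ A ν) (u : EuclideanSpace ℝ (Fin d)) :
    diffMeasure (A 0) (ν 0) u = 0 := by
  have := isFiniteMeasure_diffMeasure (hc.levy 0) (A 0) u
  refine Measure.ext_of_charFun (funext fun ξ => ?_)
  rw [charFun_diffMeasure hh (hc.levy 0) (γ 0) (hc.posSemidef 0)]
  simp [levySymbol_time_zero hh hX hc]

theorem levyMeasure_time_zero (hh : IsTruncation h) (hX : IsAdditive X P)
    (hc : IsCharTriplets h X P γ A ν) : ν 0 = 0 := by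
  refine le_antisymm (le_of_diffMeasure_le (A := A 0) (A' := 0) (hc.levy 0).zero fun u => ?_)
    (Measure.zero_le _)
  rw [diffMeasure_time_zero hh hX hc]
  exact Measure.zero_le _

theorem quadForm_time_zero (hh : IsTruncation h) (hX : IsAdditive X P)
    (hc : IsCharTriplets h X P γ A ν) (u : EuclideanSpace ℝ (Fin d)) :
    u.ofLp ⬝ᵥ (A 0 *ᵥ u.ofLp) = 0 := by
  refine le_antisymm ?_ (by simpa using (hc.posSemidef 0).dotProduct_mulVec_nonneg u.ofLp)
  have := quadForm_le_of_diffMeasure_le (A := A 0) (ν := ν 0) (A' := 0) (ν' := 0) (u := u)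
    Matrix.PosSemidef.zero (by
      rw [diffMeasure_time_zero hh hX hc]
      exact Measure.zero_le _)
  simpa using this

end Paths

/-! ### Quadratic forms and trace of the modified second characteristic -/

section Truncation

variable {d : ℕ} {ν : Measure (EuclideanSpace ℝ (Fin d))}
  {h : EuclideanSpace ℝ (Fin d) → EuclideanSpace ℝ (Fin d)}

theorem IsTruncation.exists_norm_sq_le (hh : IsTruncation h) :
    ∃ C : ℝ, 0 ≤ C ∧ ∀ x, ‖h x‖ ^ 2 ≤ C * min (‖x‖ ^ 2) 1 := by
  obtain ⟨K, hK⟩ := hh.bounded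
  obtain ⟨δ, hδ, hball⟩ := Metric.eventually_nhds_iff.1 hh.eq_self
  let η := min δ 1
  have hη : 0 < η := lt_min hδ one_pos
  have hη1 : η ≤ 1 := min_le_right _ _
  refine ⟨1 + K ^ 2 / η ^ 2, by positivity, fun x => ?_⟩
  by_cases hx : ‖x‖ < η
  · have hhx : h x = x := hball (by simpa using hx.trans_le (min_le_left _ _))
    rw [hhx, min_eq_left (by nlinarith [norm_nonneg x])]
    have : 0 ≤ K ^ 2 / η ^ 2 * ‖x‖ ^ 2 := by positivity
    linarith
  · push Not at hx
    have hmin : η ^ 2 ≤ min (‖x‖ ^ 2) 1 :=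
      le_min (pow_le_pow_left₀ hη.le hx 2) (by nlinarith)
    have h0 : 0 ≤ min (‖x‖ ^ 2) 1 := by positivity
    calc ‖h x‖ ^ 2 ≤ K ^ 2 := pow_le_pow_left₀ (norm_nonneg _) (hK x) 2
      _ = K ^ 2 / η ^ 2 * η ^ 2 := by field_simp
      _ ≤ K ^ 2 / η ^ 2 * min (‖x‖ ^ 2) 1 := by gcongr
      _ ≤ _ := by nlinarith

theorem IsTruncation.integrable_mul (hh : IsTruncation h) (hν : IsLevyMeasure ν) (j k : Fin d) :
    Integrable (fun x => h x j * h x k) ν := by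
  obtain ⟨C, -, hC⟩ := hh.exists_norm_sq_le
  have := hh.continuous
  refine hν.integrable_of_norm_le (by fun_prop) C fun x => ?_
  rw [norm_mul]
  refine le_trans ?_ (hC x)
  rw [pow_two]
  exact mul_le_mul (PiLp.norm_apply_le _ _) (PiLp.norm_apply_le _ _) (norm_nonneg _) (norm_nonneg _)

theorem IsTruncation.integrable_norm_sq (hh : IsTruncation h) (hν : IsLevyMeasure ν) :
    Integrable (fun x => ‖h x‖ ^ 2) ν := by
  obtain ⟨C, -, hC⟩ := hh.exists_norm_sq_le
  have := hh.continuous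
  exact hν.integrable_of_norm_le (by fun_prop) C fun x => by
    rw [Real.norm_of_nonneg (sq_nonneg _)]
    exact hC x

/-- Off-diagonal entries need not be monotone in time; quadratic forms are, because both summands
here are. -/
theorem quadForm_modSecondChar (hh : IsTruncation h) (hν : IsLevyMeasure ν)
    (A : Matrix (Fin d) (Fin d) ℝ) (v : EuclideanSpace ℝ (Fin d)) :
    v.ofLp ⬝ᵥ (modSecondChar h A ν *ᵥ v.ofLp) =
      v.ofLp ⬝ᵥ (A *ᵥ v.ofLp) + ∫ x, (inner ℝ v (h x)) ^ 2 ∂ν := by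
  have h1 : ∀ x, (inner ℝ v (h x)) ^ 2 = ∑ j, ∑ k, v j * (v k * (h x j * h x k)) := by
    intro x
    rw [PiLp.inner_apply, pow_two, Finset.sum_mul_sum]
    refine Finset.sum_congr rfl fun j _ => Finset.sum_congr rfl fun k _ => ?_
    simp
    ring
  simp only [h1]
  rw [integral_finsetSum _ fun j _ => integrable_finsetSum _ fun k _ =>
    ((hh.integrable_mul hν j k).const_mul _).const_mul _]
  simp only [dotProduct, Matrix.mulVec, modSecondChar, Matrix.of_apply, Finset.mul_sum, add_mul,
    mul_add, ← Finset.sum_add_distrib]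
  refine Finset.sum_congr rfl fun j _ => ?_
  rw [integral_finsetSum _ fun k _ => ((hh.integrable_mul hν j k).const_mul _).const_mul _,
    ← Finset.sum_add_distrib]
  refine Finset.sum_congr rfl fun k _ => ?_
  rw [integral_const_mul, integral_const_mul]
  ring

theorem modSecondChar_symm {A : Matrix (Fin d) (Fin d) ℝ} (hA : A.PosSemidef) (j k : Fin d) :
    modSecondChar h A ν j k = modSecondChar h A ν k j := by
  have h1 : A j k = A k j := by simpa using (hA.isHermitian.apply k j)
  simp only [modSecondChar, Matrix.of_apply, h1, mul_comm (h _ j)]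

/-- The trace of `A` is nonnegative. Convergence of the traces thus bounds `∫ ‖h‖² dν` along the
sequence. -/
theorem integral_norm_sq_le_trace (hh : IsTruncation h) (hν : IsLevyMeasure ν)
    {A : Matrix (Fin d) (Fin d) ℝ} (hA : A.PosSemidef) :
    ∫ x, ‖h x‖ ^ 2 ∂ν ≤ (modSecondChar h A ν).trace := by
  have h1 : ∀ x, ‖h x‖ ^ 2 = ∑ j, h x j * h x j := by
    intro x
    rw [EuclideanSpace.norm_sq_eq]
    simp [pow_two]
  simp only [h1]
  rw [integral_finsetSum _ fun j _ => hh.integrable_mul hν j j]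
  simp only [Matrix.trace, Matrix.diag, modSecondChar, Matrix.of_apply]
  exact Finset.sum_le_sum fun j _ => le_add_of_nonneg_left hA.diag_nonneg

end Truncation

theorem tendstoUniformlyOn_matrix {m n ι α : Type*} {F : ι → α → Matrix m n ℝ}
    {f : α → Matrix m n ℝ} {l : Filter ι} {s : Set α}
    (h : ∀ i j, TendstoUniformlyOn (fun k a => F k a i j) (fun a => f a i j) l s) :
    TendstoUniformlyOn F f l s := by
  simp only [tendstoUniformlyOn_iff_tendsto] at h ⊢
  rw [Matrix.uniformity]
  simp only [tendsto_iInf, tendsto_comap_iff]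
  exact h

/-- Polarization. -/
theorem matrix_apply_eq_quadForm {d : ℕ} {M : Matrix (Fin d) (Fin d) ℝ}
    (hM : ∀ j k, M j k = M k j) (j k : Fin d) :
    M j k = (1 / 2) * ((Pi.single j 1 + Pi.single k 1) ⬝ᵥ (M *ᵥ (Pi.single j 1 + Pi.single k 1)) -
      Pi.single j 1 ⬝ᵥ (M *ᵥ Pi.single j 1) - Pi.single k 1 ⬝ᵥ (M *ᵥ Pi.single k 1)) := by
  simp [Matrix.mulVec_add, add_dotProduct, dotProduct_add, hM k j]
  ring

/-! ### Test functions that are `o(|x|²)` at the origin -/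

section SharpSharp

variable {d : ℕ}

/-- The origin is excluded because in dimension zero the punctured limit says nothing about `f 0`;
Lévy measures do not charge it. -/
theorem CSharpSharp.exists_norm_le {f : EuclideanSpace ℝ (Fin d) →ᵇ ℝ} (hf : f ∈ CSharpSharp d) :
    ∃ C : ℝ, ∀ x, x ≠ 0 → ‖f x‖ ≤ C * min (‖x‖ ^ 2) 1 := by
  have h1 : ∀ᶠ x in 𝓝[≠] (0 : EuclideanSpace ℝ (Fin d)), ‖f x / ‖x‖ ^ 2‖ < 1 := by
    have : Tendsto (fun x => ‖f x / ‖x‖ ^ 2‖) (𝓝[≠] 0) (𝓝 ‖(0 : ℝ)‖) := Tendsto.norm hf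
    rw [norm_zero] at this
    exact this.eventually_lt_const one_pos
  rw [eventually_nhdsWithin_iff] at h1
  obtain ⟨δ, hδ, hball⟩ := Metric.eventually_nhds_iff.1 h1
  let η := min δ 1
  have hη : 0 < η := lt_min hδ one_pos
  have hη1 : η ≤ 1 := min_le_right _ _
  refine ⟨1 + ‖f‖ / η ^ 2, fun x hx0 => ?_⟩
  have hxpos : 0 < ‖x‖ := norm_pos_iff.2 hx0
  by_cases hx : ‖x‖ < η
  · have h2 := hball (y := x) (by simpa using hx.trans_le (min_le_left _ _)) hx0
    rw [norm_div, norm_pow, norm_norm, div_lt_one (by positivity)] at h2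
    rw [min_eq_left (by nlinarith)]
    have : 0 ≤ ‖f‖ / η ^ 2 * ‖x‖ ^ 2 := by positivity
    linarith
  · push Not at hx
    have hmin : η ^ 2 ≤ min (‖x‖ ^ 2) 1 :=
      le_min (pow_le_pow_left₀ hη.le hx 2) (by nlinarith)
    have h0 : 0 ≤ min (‖x‖ ^ 2) 1 := by positivity
    calc ‖f x‖ ≤ ‖f‖ := f.norm_coe_le_norm x
      _ = ‖f‖ / η ^ 2 * η ^ 2 := by field_simp
      _ ≤ ‖f‖ / η ^ 2 * min (‖x‖ ^ 2) 1 := by gcongr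
      _ ≤ _ := by nlinarith

theorem CSharpSharp.integrable {f : EuclideanSpace ℝ (Fin d) →ᵇ ℝ} (hf : f ∈ CSharpSharp d)
    {ν : Measure (EuclideanSpace ℝ (Fin d))} (hν : IsLevyMeasure ν) : Integrable f ν := by
  obtain ⟨C, hC⟩ := CSharpSharp.exists_norm_le hf
  exact hν.integrable_of_norm_le_of_ne f.continuous.aestronglyMeasurable C hC

theorem CSharp.subset_CSharpSharp {f : EuclideanSpace ℝ (Fin d) →ᵇ ℝ} (hf : f ∈ CSharp d) :
    f ∈ CSharpSharp d := by
  refine tendsto_const_nhds.congr' ?_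
  filter_upwards [nhdsWithin_le_nhds hf] with x hx
  have hx : f x = 0 := hx
  simp [hx]

theorem CSharpSharp.of_abs_le {f g : EuclideanSpace ℝ (Fin d) →ᵇ ℝ} (hf : f ∈ CSharpSharp d)
    (hgf : ∀ x, |g x| ≤ |f x|) : g ∈ CSharpSharp d := by
  have h1 : Tendsto (fun x => |f x / ‖x‖ ^ 2|) (𝓝[≠] 0) (𝓝 0) := by
    simpa using Tendsto.abs hf
  refine squeeze_zero_norm (fun x => ?_) h1
  rw [Real.norm_eq_abs, abs_div, abs_div]
  exact div_le_div_of_nonneg_right (hgf x) (abs_nonneg _)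

/-- Near the origin, a function in `CSharpSharp` is a negligible multiple of `‖h x‖ ^ 2` up to a
function in `CSharp`. -/
theorem CSharpSharp.exists_CSharp_approx
    {h : EuclideanSpace ℝ (Fin d) → EuclideanSpace ℝ (Fin d)} (hh : IsTruncation h)
    {f : EuclideanSpace ℝ (Fin d) →ᵇ ℝ} (hf : f ∈ CSharpSharp d) {ε : ℝ} (hε : 0 < ε) :
    ∃ g ∈ CSharp d, ∀ x, x ≠ 0 → ‖f x - g x‖ ≤ ε * ‖h x‖ ^ 2 := by
  have h1 : ∀ᶠ x in 𝓝[≠] (0 : EuclideanSpace ℝ (Fin d)), ‖f x / ‖x‖ ^ 2‖ < ε := by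
    have : Tendsto (fun x => ‖f x / ‖x‖ ^ 2‖) (𝓝[≠] 0) (𝓝 ‖(0 : ℝ)‖) := Tendsto.norm hf
    rw [norm_zero] at this
    exact this.eventually_lt_const hε
  rw [eventually_nhdsWithin_iff] at h1
  obtain ⟨δ, hδ, hball⟩ := Metric.eventually_nhds_iff.1 (h1.and hh.eq_self)
  -- A cutoff equal to `0` for `‖x‖ ≤ δ / 4` and to `1` for `‖x‖ ≥ δ / 2`.
  let c : EuclideanSpace ℝ (Fin d) → ℝ := fun x => min 1 (max 0 (4 * ‖x‖ / δ - 1))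
  have hc0 : ∀ x, 0 ≤ c x := fun x => le_min zero_le_one (le_max_left _ _)
  have hc1 : ∀ x, c x ≤ 1 := fun x => min_le_left _ _
  let χ : EuclideanSpace ℝ (Fin d) →ᵇ ℝ := BoundedContinuousFunction.ofNormedAddCommGroup c
    (by fun_prop) 1 fun x => by rw [Real.norm_of_nonneg (hc0 x)]; exact hc1 x
  have hχ : ∀ x, χ x = c x := fun x => rfl
  refine ⟨f * χ, ?_, fun x hx => ?_⟩
  · change ∀ᶠ x in 𝓝 0, (f * χ) x = 0
    filter_upwards [Metric.ball_mem_nhds (0 : EuclideanSpace ℝ (Fin d))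
      (show 0 < δ / 4 by positivity)] with x hx
    have hx : ‖x‖ < δ / 4 := by simpa using hx
    have h2 : 4 * ‖x‖ / δ - 1 ≤ 0 := by
      rw [sub_nonpos, div_le_one hδ]
      linarith
    simp [hχ, c, max_eq_left h2]
  · rw [BoundedContinuousFunction.mul_apply, hχ, ← mul_one_sub, norm_mul]
    have hxpos : 0 < ‖x‖ := norm_pos_iff.2 hx
    by_cases hxδ : ‖x‖ < δ
    · obtain ⟨h2, h3⟩ := hball (y := x) (by simpa using hxδ)
      have h2 := h2 hx
      rw [norm_div, norm_pow, norm_norm, div_lt_iff₀ (by positivity)] at h2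
      rw [h3]
      have h4 : ‖1 - c x‖ ≤ 1 := by
        rw [Real.norm_eq_abs, abs_le]
        constructor <;> linarith [hc0 x, hc1 x]
      exact (mul_le_of_le_one_right (norm_nonneg _) h4).trans h2.le
    · push Not at hxδ
      have h2 : 1 ≤ 4 * ‖x‖ / δ - 1 := by
        have : 4 ≤ 4 * ‖x‖ / δ := by
          rw [le_div_iff₀ hδ]
          linarith
        linarith
      have h3 : c x = 1 := by
        simp only [c]
        rw [max_eq_right (by linarith), min_eq_left h2]
      rw [h3]
      simp only [sub_self, norm_zero, mul_zero]
      positivity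

/-- Replacing `f` by a function vanishing near the origin costs at most a small multiple of `∫
‖h‖²`, hence of the trace, which is eventually bounded uniformly in `n`. -/
theorem tendsto_integral_of_CSharpSharp
    {h : EuclideanSpace ℝ (Fin d) → EuclideanSpace ℝ (Fin d)} (hh : IsTruncation h)
    {ν : Measure (EuclideanSpace ℝ (Fin d))} (hν : IsLevyMeasure ν)
    {A : Matrix (Fin d) (Fin d) ℝ} (hA : A.PosSemidef)
    {νs : ℕ → Measure (EuclideanSpace ℝ (Fin d))} (hνs : ∀ n, IsLevyMeasure (νs n))
    {As : ℕ → Matrix (Fin d) (Fin d) ℝ} (hAs : ∀ n, (As n).PosSemidef)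
    (hmod : Tendsto (fun n => modSecondChar h (As n) (νs n)) atTop (𝓝 (modSecondChar h A ν)))
    (hsharp : ∀ g ∈ CSharp d, Tendsto (fun n => ∫ x, g x ∂(νs n)) atTop (𝓝 (∫ x, g x ∂ν)))
    {f : EuclideanSpace ℝ (Fin d) →ᵇ ℝ} (hf : f ∈ CSharpSharp d) :
    Tendsto (fun n => ∫ x, f x ∂(νs n)) atTop (𝓝 (∫ x, f x ∂ν)) := by
  have htr : Tendsto (fun n => (modSecondChar h (As n) (νs n)).trace) atTop
      (𝓝 (modSecondChar h A ν).trace) :=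
    (Continuous.matrix_trace continuous_id).continuousAt.tendsto.comp hmod
  set K := (modSecondChar h A ν).trace with hK
  have hK0 : 0 ≤ K :=
    (integral_nonneg fun x => sq_nonneg _).trans (integral_norm_sq_le_trace hh hν hA)
  rw [Metric.tendsto_atTop']
  intro ε hε
  -- Each of the two replacement errors is then below `ε / 4`, which leaves `ε / 2` for the
  -- convergence of `∫ g`.
  let η := ε / (4 * (K + 1))
  have hη : 0 < η := by positivity
  have hηK : η * (K + 1) = ε / 4 := by
    simp only [η]
    field_simp
  obtain ⟨g, hg, hfg⟩ := CSharpSharp.exists_CSharp_approx hh hf hη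
  have hbound : ∀ (μ : Measure (EuclideanSpace ℝ (Fin d))) (B : Matrix (Fin d) (Fin d) ℝ),
      IsLevyMeasure μ → B.PosSemidef →
      |∫ x, f x ∂μ - ∫ x, g x ∂μ| ≤ η * (modSecondChar h B μ).trace := by
    intro μ B hμ hB
    rw [← integral_sub (CSharpSharp.integrable hf hμ)
      (CSharpSharp.integrable (CSharp.subset_CSharpSharp hg) hμ), ← Real.norm_eq_abs]
    refine (norm_integral_le_of_norm_le ((hh.integrable_norm_sq hμ).const_mul η)
      (hμ.ae_ne_zero.mono fun x hx => hfg x hx)).trans ?_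
    rw [integral_const_mul]
    gcongr
    exact integral_norm_sq_le_trace hh hμ hB
  have h1 := htr.eventually_lt_const (show K < K + 1 by linarith)
  have h2 := (hsharp g hg).eventually (Metric.ball_mem_nhds _ (show 0 < ε / 2 by positivity))
  obtain ⟨N, hN⟩ := eventually_atTop.1 (h1.and h2)
  refine ⟨N, fun n hn => ?_⟩
  obtain ⟨h3, h4⟩ := hN n hn.le
  have h5 := hbound (νs n) (As n) (hνs n) (hAs n)
  have h6 := hbound ν A hν hA
  have h7 : η * (modSecondChar h (As n) (νs n)).trace < η * (K + 1) := by gcongr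
  have h8 : η * (modSecondChar h A ν).trace < η * (K + 1) := by
    rw [← hK]
    gcongr
    linarith
  rw [Real.dist_eq] at h4 ⊢
  rw [abs_lt] at h4 ⊢
  rw [abs_le] at h5 h6
  constructor <;> linarith

end SharpSharp

/-! ### The modified second characteristic as a function of time -/

section Paths

variable {d : ℕ} {Ω : Type*} [MeasurableSpace Ω] {P : Measure Ω} [IsProbabilityMeasure P]
  {X : ℝ≥0 → Ω → EuclideanSpace ℝ (Fin d)}
  {h : EuclideanSpace ℝ (Fin d) → EuclideanSpace ℝ (Fin d)}
  {γ : ℝ≥0 → EuclideanSpace ℝ (Fin d)} {A : ℝ≥0 → Matrix (Fin d) (Fin d) ℝ}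
  {ν : ℝ≥0 → Measure (EuclideanSpace ℝ (Fin d))}

theorem inner_sq_le (hh : IsTruncation h) (v : EuclideanSpace ℝ (Fin d)) :
    ∃ C : ℝ, ∀ x, (inner ℝ v (h x)) ^ 2 ≤ C * min (‖x‖ ^ 2) 1 := by
  obtain ⟨C, -, hC⟩ := hh.exists_norm_sq_le
  refine ⟨‖v‖ ^ 2 * C, fun x => ?_⟩
  calc (inner ℝ v (h x)) ^ 2 ≤ (‖v‖ * ‖h x‖) ^ 2 := by
        rw [← sq_abs (inner ℝ v (h x))]
        exact pow_le_pow_left₀ (abs_nonneg _) (abs_real_inner_le_norm _ _) 2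
    _ = ‖v‖ ^ 2 * ‖h x‖ ^ 2 := by ring
    _ ≤ ‖v‖ ^ 2 * (C * min (‖x‖ ^ 2) 1) := by gcongr; exact hC x
    _ = _ := by ring

theorem monotone_quadForm_modSecondChar (hh : IsTruncation h) (hX : IsAdditive X P)
    (hc : IsCharTriplets h X P γ A ν) (v : EuclideanSpace ℝ (Fin d)) :
    Monotone fun t => v.ofLp ⬝ᵥ (modSecondChar h (A t) (ν t) *ᵥ v.ofLp) := by
  simp only [quadForm_modSecondChar hh (hc.levy _)]
  obtain ⟨C, hC⟩ := inner_sq_le hh v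
  have := hh.continuous
  refine (monotone_quadForm hh hX hc v).add (monotone_integral hh hX hc (fun t => ?_)
    fun x _ => sq_nonneg _)
  exact (hc.levy t).integrable_of_norm_le (by fun_prop) C fun x => by
    rw [Real.norm_of_nonneg (sq_nonneg _)]
    exact hC x

theorem continuous_quadForm_modSecondChar (hh : IsTruncation h) (hX : IsAdditive X P)
    (hc : IsCharTriplets h X P γ A ν) (v : EuclideanSpace ℝ (Fin d)) :
    Continuous fun t => v.ofLp ⬝ᵥ (modSecondChar h (A t) (ν t) *ᵥ v.ofLp) := by
  simp only [quadForm_modSecondChar hh (hc.levy _)]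
  obtain ⟨C, hC⟩ := inner_sq_le hh v
  have := hh.continuous
  exact (continuous_quadForm hh hX hc v).add (continuous_integral hh hX hc
    (Continuous.measurable (by fun_prop)) (fun x _ => sq_nonneg _) fun x _ => hC x)

theorem quadForm_modSecondChar_time_zero (hh : IsTruncation h) (hX : IsAdditive X P)
    (hc : IsCharTriplets h X P γ A ν) (v : EuclideanSpace ℝ (Fin d)) :
    v.ofLp ⬝ᵥ (modSecondChar h (A 0) (ν 0) *ᵥ v.ofLp) = 0 := by
  rw [quadForm_modSecondChar hh (hc.levy _), quadForm_time_zero hh hX hc,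
    levyMeasure_time_zero hh hX hc]
  simp

theorem modSecondChar_time_zero (hh : IsTruncation h) (hX : IsAdditive X P)
    (hc : IsCharTriplets h X P γ A ν) : modSecondChar h (A 0) (ν 0) = 0 := by
  ext j k
  have hq : ∀ v, v ⬝ᵥ (modSecondChar h (A 0) (ν 0) *ᵥ v) = 0 := fun v =>
    quadForm_modSecondChar_time_zero hh hX hc (WithLp.toLp 2 v)
  rw [matrix_apply_eq_quadForm (modSecondChar_symm (hc.posSemidef 0)) j k]
  simp only [hq]
  simp

end Paths

end AdditiveProcess

/-! ### Locally uniform convergence -/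

theorem mainTheorem7 {d : ℕ}
    (h : EuclideanSpace ℝ (Fin d) → EuclideanSpace ℝ (Fin d))
    (hh : AdditiveProcess.IsTruncation h)
    -- the limit process and its characteristic triplets
    {Ω : Type*} [MeasurableSpace Ω] (P : Measure Ω) [IsProbabilityMeasure P]
    (X : ℝ≥0 → Ω → EuclideanSpace ℝ (Fin d)) (hX : AdditiveProcess.IsAdditive X P)
    (γ : ℝ≥0 → EuclideanSpace ℝ (Fin d)) (A : ℝ≥0 → Matrix (Fin d) (Fin d) ℝ)
    (ν : ℝ≥0 → Measure (EuclideanSpace ℝ (Fin d)))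
    (hchar : AdditiveProcess.IsCharTriplets h X P γ A ν)
    -- the approximating processes, each on its own probability space
    {Ωs : ℕ → Type*} [∀ n, MeasurableSpace (Ωs n)] (Ps : ∀ n, Measure (Ωs n))
    [∀ n, IsProbabilityMeasure (Ps n)]
    (Xs : ∀ n, ℝ≥0 → Ωs n → EuclideanSpace ℝ (Fin d))
    (hXs : ∀ n, AdditiveProcess.IsAdditive (Xs n) (Ps n))
    (γs : ℕ → ℝ≥0 → EuclideanSpace ℝ (Fin d)) (As : ℕ → ℝ≥0 → Matrix (Fin d) (Fin d) ℝ)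
    (νs : ℕ → ℝ≥0 → Measure (EuclideanSpace ℝ (Fin d)))
    (hchars : ∀ n, AdditiveProcess.IsCharTriplets h (Xs n) (Ps n) (γs n) (As n) (νs n))
    -- pointwise convergence of the modified second characteristics
    (hA : ∀ t : ℝ≥0, 0 < t →
      Tendsto (fun n => AdditiveProcess.modSecondChar h (As n t) (νs n t)) atTop
        (𝓝 (AdditiveProcess.modSecondChar h (A t) (ν t)))) :
    (∀ T : ℝ≥0, 0 < T →
      TendstoUniformlyOn (fun n t => AdditiveProcess.modSecondChar h (As n t) (νs n t))
        (fun t => AdditiveProcess.modSecondChar h (A t) (ν t)) atTop (Set.Icc 0 T)) ∧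
    ((∀ t : ℝ≥0, 0 < t → ∀ f ∈ AdditiveProcess.CSharp d,
        Tendsto (fun n => ∫ x, f x ∂(νs n t)) atTop (𝓝 (∫ x, f x ∂(ν t)))) →
      ∀ T : ℝ≥0, 0 < T → ∀ f ∈ AdditiveProcess.CSharpSharp d,
        TendstoUniformlyOn (fun n t => ∫ x, f x ∂(νs n t)) (fun t => ∫ x, f x ∂(ν t))
          atTop (Set.Icc 0 T)) := by
  -- At `t = 0` all modified characteristics vanish, so convergence extends to the closed half-line.
  have hA' : ∀ t : ℝ≥0,
      Tendsto (fun n => AdditiveProcess.modSecondChar h (As n t) (νs n t)) atTop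
        (𝓝 (AdditiveProcess.modSecondChar h (A t) (ν t))) := by
    intro t
    rcases eq_or_lt_of_le (zero_le (a := t)) with rfl | ht
    · simp only [AdditiveProcess.modSecondChar_time_zero hh hX hchar,
        AdditiveProcess.modSecondChar_time_zero hh (hXs _) (hchars _)]
      exact tendsto_const_nhds
    · exact hA t ht
  refine ⟨fun T _ => ?_, fun hsharp T _ f hf => ?_⟩
  · have hquad : ∀ v : Fin d → ℝ, TendstoUniformlyOn
        (fun n t => v ⬝ᵥ (AdditiveProcess.modSecondChar h (As n t) (νs n t) *ᵥ v))
        (fun t => v ⬝ᵥ (AdditiveProcess.modSecondChar h (A t) (ν t) *ᵥ v)) atTop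
        (Set.Icc 0 T) := by
      intro v
      refine AdditiveProcess.tendstoUniformlyOn_of_monotone (fun n =>
        AdditiveProcess.monotone_quadForm_modSecondChar hh (hXs n) (hchars n) (WithLp.toLp 2 v))
        (AdditiveProcess.continuous_quadForm_modSecondChar hh hX hchar (WithLp.toLp 2 v))
        (fun t => ?_) T
      have hcont : Continuous fun M : Matrix (Fin d) (Fin d) ℝ => v ⬝ᵥ (M *ᵥ v) := by fun_prop
      exact (hcont.tendsto _).comp (hA' t)
    refine AdditiveProcess.tendstoUniformlyOn_matrix fun j k => ?_
    have h1 := ((hquad (Pi.single j 1 + Pi.single k 1)).sub (hquad (Pi.single j 1))).sub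
      (hquad (Pi.single k 1))
    have h2 := (uniformContinuous_const_smul (1 / 2 : ℝ)).comp_tendstoUniformlyOn h1
    refine (h2.congr (Eventually.of_forall fun n t _ => ?_)).congr_right fun t _ => ?_
    · exact (AdditiveProcess.matrix_apply_eq_quadForm
        (AdditiveProcess.modSecondChar_symm ((hchars n).posSemidef t)) j k).symm
    · exact (AdditiveProcess.matrix_apply_eq_quadForm
        (AdditiveProcess.modSecondChar_symm (hchar.posSemidef t)) j k).symm
  · have hsharp' : ∀ t : ℝ≥0, ∀ g ∈ AdditiveProcess.CSharp d,
        Tendsto (fun n => ∫ x, g x ∂(νs n t)) atTop (𝓝 (∫ x, g x ∂(ν t))) := by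
      intro t
      rcases eq_or_lt_of_le (zero_le (a := t)) with rfl | ht
      · simp [AdditiveProcess.levyMeasure_time_zero hh hX hchar,
          AdditiveProcess.levyMeasure_time_zero hh (hXs _) (hchars _)]
      · exact hsharp t ht
    have hpos : ∀ g ∈ AdditiveProcess.CSharpSharp d, (∀ x, 0 ≤ g x) →
        TendstoUniformlyOn (fun n t => ∫ x, g x ∂(νs n t)) (fun t => ∫ x, g x ∂(ν t))
          atTop (Set.Icc 0 T) := by
      intro g hg hg0
      obtain ⟨C, hC⟩ := AdditiveProcess.CSharpSharp.exists_norm_le hg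
      refine AdditiveProcess.tendstoUniformlyOn_of_monotone (fun n =>
        AdditiveProcess.monotone_integral hh (hXs n) (hchars n)
          (fun t => AdditiveProcess.CSharpSharp.integrable hg ((hchars n).levy t))
          fun x _ => hg0 x)
        (AdditiveProcess.continuous_integral hh hX hchar g.continuous.measurable
          (fun x _ => hg0 x) fun x hx => (le_abs_self _).trans (hC x hx))
        (fun t => ?_) T
      exact AdditiveProcess.tendsto_integral_of_CSharpSharp hh (hchar.levy t)
        (hchar.posSemidef t) (fun n => (hchars n).levy t) (fun n => (hchars n).posSemidef t)
        (hA' t) (hsharp' t) hg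
    -- Integrals against `ν_t` are monotone in time only for nonnegative integrands, so `f` is split
    -- into its positive and negative parts.
    have hf₁ : f ⊔ 0 ∈ AdditiveProcess.CSharpSharp d := .of_abs_le hf fun x => by
      change |max (f x) 0| ≤ |f x|
      rw [abs_of_nonneg (le_max_right _ _)]
      exact max_le (le_abs_self _) (abs_nonneg _)
    have hf₂ : -f ⊔ 0 ∈ AdditiveProcess.CSharpSharp d := .of_abs_le hf fun x => by
      change |max (-f x) 0| ≤ |f x|
      rw [abs_of_nonneg (le_max_right _ _)]
      exact max_le (neg_le_abs _) (abs_nonneg _)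
    have hsplit : ∀ μ, AdditiveProcess.IsLevyMeasure μ →
        ∫ x, (f ⊔ 0) x ∂μ - ∫ x, (-f ⊔ 0) x ∂μ = ∫ x, f x ∂μ := by
      intro μ hμ
      rw [← integral_sub (AdditiveProcess.CSharpSharp.integrable hf₁ hμ)
        (AdditiveProcess.CSharpSharp.integrable hf₂ hμ)]
      refine integral_congr_ae (ae_of_all _ fun x => ?_)
      change max (f x) 0 - max (-f x) 0 = f x
      rcases le_total 0 (f x) with h0 | h0
      · rw [max_eq_left h0, max_eq_right (by linarith), sub_zero]
      · rw [max_eq_right h0, max_eq_left (by linarith), zero_sub, neg_neg]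
    have h1 := (hpos _ hf₁ fun x => le_max_right _ _).sub (hpos _ hf₂ fun x => le_max_right _ _)
    refine (h1.congr (Eventually.of_forall fun n t _ => ?_)).congr_right fun t _ => ?_
    · exact hsplit _ ((hchars n).levy t)
    · exact hsplit _ (hchar.levy t)
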